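/- Let $n\ge 3$, let $\Omega\subset\mathbb R^n$ be a bounded domain (a nonempty connected open set) with smooth boundary, and let $q\in L^{n/2}(\Omega,\mathbb R)$. Consider the Schrödinger operator $-\Delta+q$ with form domain $H^1_0(\Omega)$: a real number $\lambda$ is a Dirichlet eigenvalue with eigenfunction $0\ne\varphi\in H^1_0(\Omega)$ if $$\int_\Omega\big(\nabla\varphi\cdot\overline{\nabla v}+q\,\varphi\,\overline v\big)\,dx=\lambda\int_\Omega\varphi\,\overline v\,dx\qquad\text{for all }v\in H^1_0(\Omega).$$ Then $L^2(\Omega)$ has an orthonormal basis $(\varphi_k)_{k\ge1}$ of such eigenfunctions whose eigenvalues, repeated according to multiplicity, form a nondecreasing sequence $\lambda_1\le\lambda_2\le\cdots$; and for every such sequence $$\lambda_k\sim\frac{4\pi^2}{(V_B\,V_\Omega)^{2/n}}\,k^{2/n}\qquad\text{as }k\to\infty,$$ where $V_B$ is the volume of the unit ball of $\mathbb R^n$ and $V_\Omega$ is the volume of $\Omega$ (and $a_k\sim b_k$ means $a_k/b_k\to1$). -/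

import Mathlib

open MeasureTheory Filter Topology Asymptotics
open scoped ContDiff ENNReal ComplexConjugate

/-- Bounded domain (open, connected, nonempty) in `ℝⁿ` with smooth boundary: near each boundary
point some smooth diffeomorphism between open sets of `ℝⁿ` carries the domain to the side
`{z | 0 < z i}` of a coordinate hyperplane (hence the boundary to the hyperplane itself). -/
structure IsSmoothBoundedDomain {n : ℕ} (Ω : Set (EuclideanSpace ℝ (Fin n))) : Prop where
  isOpen : IsOpen Ω
  isConnected : IsConnected Ω
  isBounded : Bornology.IsBounded Ω
  smooth_boundary : ∀ x ∈ frontier Ω,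
    ∃ (e : OpenPartialHomeomorph (EuclideanSpace ℝ (Fin n)) (EuclideanSpace ℝ (Fin n)))
      (i : Fin n), x ∈ e.source ∧
        ContDiffOn ℝ ∞ e e.source ∧ ContDiffOn ℝ ∞ e.symm e.target ∧
        ∀ y ∈ e.source, y ∈ Ω ↔ 0 < e y i

/-- The complex Hilbert space `L²(Ω)`. -/
abbrev L2Space {n : ℕ} (Ω : Set (EuclideanSpace ℝ (Fin n))) : Type :=
  Lp ℂ 2 (volume.restrict Ω)

/-- `φ ∈ C_c^∞(Ω)`. -/
structure IsTestFunction {n : ℕ} (Ω : Set (EuclideanSpace ℝ (Fin n)))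
    (φ : EuclideanSpace ℝ (Fin n) → ℂ) : Prop where
  contDiff : ContDiff ℝ ∞ φ
  hasCompactSupport : HasCompactSupport φ
  tsupport_subset : tsupport φ ⊆ Ω

/-- The classical partial derivative `∂ᵢ φ`. -/
noncomputable def partialDeriv {n : ℕ} (i : Fin n) (φ : EuclideanSpace ℝ (Fin n) → ℂ)
    (x : EuclideanSpace ℝ (Fin n)) : ℂ :=
  fderiv ℝ φ x (EuclideanSpace.single i 1)

/-- `g` is the `i`-th weak partial derivative of `u` on `Ω`. -/
def HasWeakPartialDeriv {n : ℕ} (Ω : Set (EuclideanSpace ℝ (Fin n))) (i : Fin n)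
    (u g : L2Space Ω) : Prop :=
  ∀ φ : EuclideanSpace ℝ (Fin n) → ℂ, IsTestFunction Ω φ →
    ∫ x in Ω, u x * partialDeriv i φ x = -∫ x in Ω, g x * φ x

/-- `u ∈ H¹₀(Ω)` with weak gradient `G`: `G ∈ L²(Ω)ⁿ` is the weak gradient of `u ∈ L²(Ω)`, and
`u` is a limit of test functions in the `H¹(Ω)`-norm. -/
structure IsH10WithGradient {n : ℕ} (Ω : Set (EuclideanSpace ℝ (Fin n)))
    (u : L2Space Ω) (G : Fin n → L2Space Ω) : Prop where
  weakGradient : ∀ i, HasWeakPartialDeriv Ω i u (G i)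
  approx : ∃ φ : ℕ → EuclideanSpace ℝ (Fin n) → ℂ, (∀ j, IsTestFunction Ω (φ j)) ∧
    Tendsto (fun j => eLpNorm (fun x => φ j x - u x) 2 (volume.restrict Ω)) atTop (𝓝 0) ∧
    ∀ i, Tendsto (fun j => eLpNorm (fun x => partialDeriv i (φ j) x - G i x) 2
      (volume.restrict Ω)) atTop (𝓝 0)

/-- The sesquilinear form `Φ(u, v) = ∫_Ω ∇u · conj ∇v + q u conj v`, for `u`, `v` with weak
gradients `G`, `H`. -/
noncomputable def schrodingerForm {n : ℕ} (Ω : Set (EuclideanSpace ℝ (Fin n)))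
    (q : EuclideanSpace ℝ (Fin n) → ℝ) (u : L2Space Ω) (G : Fin n → L2Space Ω)
    (v : L2Space Ω) (H : Fin n → L2Space Ω) : ℂ :=
  ∫ x in Ω, ((∑ i, G i x * conj (H i x)) + (q x : ℂ) * u x * conj (v x))

/-- `u ∈ H¹₀(Ω)` solves `(-Δ + q) u = μ u` weakly, i.e. `Φ(u, v) = μ ∫_Ω u conj v` for all
`v ∈ H¹₀(Ω)`. -/
def IsDirichletEigenvector {n : ℕ} (Ω : Set (EuclideanSpace ℝ (Fin n)))
    (q : EuclideanSpace ℝ (Fin n) → ℝ) (μ : ℝ) (u : L2Space Ω) : Prop :=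
  ∃ G : Fin n → L2Space Ω, IsH10WithGradient Ω u G ∧
    ∀ (v : L2Space Ω) (H : Fin n → L2Space Ω), IsH10WithGradient Ω v H →
      schrodingerForm Ω q u G v H = (μ : ℂ) * ∫ x in Ω, u x * conj (v x)

/-- `lam 0 ≤ lam 1 ≤ ⋯` are the Dirichlet eigenvalues of `-Δ + q`, repeated according to
multiplicity: they belong to a complete orthonormal system of eigenfunctions of `L²(Ω)`.
The index is shifted by one: `lam k` is the `(k + 1)`-st eigenvalue. -/
def IsDirichletEigenvalueSequence {n : ℕ} (Ω : Set (EuclideanSpace ℝ (Fin n)))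
    (q : EuclideanSpace ℝ (Fin n) → ℝ) (lam : ℕ → ℝ) : Prop :=
  Monotone lam ∧
    ∃ b : HilbertBasis ℕ ℂ (L2Space Ω), ∀ k, IsDirichletEigenvector Ω q (lam k) (b k)

/-! ### Test functions and the Sobolev space `H¹₀(Ω)` as a Hilbert space -/

namespace IsTestFunction

variable {n : ℕ} {Ω : Set (EuclideanSpace ℝ (Fin n))} {φ ψ : EuclideanSpace ℝ (Fin n) → ℂ}

theorem zero : IsTestFunction Ω (0 : EuclideanSpace ℝ (Fin n) → ℂ) :=
  ⟨contDiff_const, HasCompactSupport.zero, by simp [tsupport]⟩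

theorem add (hφ : IsTestFunction Ω φ) (hψ : IsTestFunction Ω ψ) : IsTestFunction Ω (φ + ψ) :=
  ⟨hφ.contDiff.add hψ.contDiff, hφ.hasCompactSupport.add hψ.hasCompactSupport,
    (tsupport_add φ ψ).trans (Set.union_subset hφ.tsupport_subset hψ.tsupport_subset)⟩

theorem smul (hφ : IsTestFunction Ω φ) (c : ℂ) : IsTestFunction Ω (c • φ) :=
  ⟨contDiff_const.smul hφ.contDiff, hφ.hasCompactSupport.smul_left,
    (closure_mono (Function.support_const_smul_subset c φ)).trans hφ.tsupport_subset⟩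

theorem mul_left {g : EuclideanSpace ℝ (Fin n) → ℂ} (hφ : IsTestFunction Ω φ)
    (hg : ContDiff ℝ ∞ g) : IsTestFunction Ω (g * φ) :=
  ⟨hg.mul hφ.contDiff, hφ.hasCompactSupport.mul_left,
    (tsupport_mul_subset_right).trans hφ.tsupport_subset⟩

theorem differentiable (hφ : IsTestFunction Ω φ) : Differentiable ℝ φ :=
  hφ.contDiff.differentiable (by simp)

theorem partialDeriv (hφ : IsTestFunction Ω φ) (i : Fin n) :
    IsTestFunction Ω (partialDeriv i φ) :=
  ⟨(hφ.contDiff.fderiv_right (m := ∞) (by simp)).clm_apply contDiff_const,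
    hφ.hasCompactSupport.fderiv_apply ℝ _,
    (tsupport_fderiv_apply_subset ℝ _).trans hφ.tsupport_subset⟩

theorem continuous (hφ : IsTestFunction Ω φ) : Continuous φ := hφ.contDiff.continuous

theorem memLp (hφ : IsTestFunction Ω φ) (p : ℝ≥0∞)
    (μ : Measure (EuclideanSpace ℝ (Fin n))) [IsFiniteMeasureOnCompacts μ] : MemLp φ p μ :=
  hφ.continuous.memLp_of_hasCompactSupport hφ.hasCompactSupport

theorem integrable (hφ : IsTestFunction Ω φ) (μ : Measure (EuclideanSpace ℝ (Fin n)))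
    [IsFiniteMeasureOnCompacts μ] : Integrable φ μ :=
  hφ.continuous.integrable_of_hasCompactSupport hφ.hasCompactSupport

theorem eq_zero_of_notMem (hφ : IsTestFunction Ω φ) {x : EuclideanSpace ℝ (Fin n)}
    (hx : x ∉ Ω) : φ x = 0 :=
  image_eq_zero_of_notMem_tsupport fun h => hx (hφ.tsupport_subset h)

/-- The class of a test function in `L²(Ω)`. -/
noncomputable def toL2 (hφ : IsTestFunction Ω φ) : L2Space Ω :=
  (hφ.memLp 2 (volume.restrict Ω)).toLp φ

theorem coeFn_toL2 (hφ : IsTestFunction Ω φ) : hφ.toL2 =ᵐ[volume.restrict Ω] φ :=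
  (hφ.memLp 2 (volume.restrict Ω)).coeFn_toLp

theorem tendsto_toL2_iff {φ : ℕ → EuclideanSpace ℝ (Fin n) → ℂ}
    (hφ : ∀ j, IsTestFunction Ω (φ j)) (u : L2Space Ω) :
    Tendsto (fun j => (hφ j).toL2) atTop (𝓝 u) ↔
      Tendsto (fun j => eLpNorm (fun x => φ j x - u x) 2 (volume.restrict Ω)) atTop (𝓝 0) := by
  rw [Lp.tendsto_Lp_iff_tendsto_eLpNorm']
  refine iff_of_eq (congrArg (fun f => Tendsto f atTop (𝓝 0)) (funext fun j => ?_))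
  refine eLpNorm_congr_ae ?_
  filter_upwards [(hφ j).coeFn_toL2] with x hx
  simp [hx]

end IsTestFunction

theorem partialDeriv_add {n : ℕ} {φ ψ : EuclideanSpace ℝ (Fin n) → ℂ} (i : Fin n)
    (hφ : Differentiable ℝ φ) (hψ : Differentiable ℝ ψ) :
    partialDeriv i (φ + ψ) = partialDeriv i φ + partialDeriv i ψ := by
  ext x
  simp [partialDeriv, fderiv_add (hφ x) (hψ x)]

theorem partialDeriv_smul {n : ℕ} {φ : EuclideanSpace ℝ (Fin n) → ℂ} (i : Fin n) (c : ℂ)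
    (hφ : Differentiable ℝ φ) :
    partialDeriv i (c • φ) = c • partialDeriv i φ := by
  ext x
  simp [partialDeriv, fderiv_const_smul (hφ x) c]

section SobolevSpace

variable {n : ℕ} (Ω : Set (EuclideanSpace ℝ (Fin n)))

/-- The Hilbert space `L²(Ω) ⊕ L²(Ω)ⁿ`, in which a function is paired with its gradient. -/
abbrev JetSpace : Type := WithLp 2 (L2Space Ω × PiLp 2 (fun _ : Fin n => L2Space Ω))

variable {Ω}

/-- The pair `(φ, ∇φ)` of a test function. -/
noncomputable def IsTestFunction.jet {φ : EuclideanSpace ℝ (Fin n) → ℂ}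
    (hφ : IsTestFunction Ω φ) : JetSpace Ω :=
  WithLp.toLp 2 (hφ.toL2, WithLp.toLp 2 fun i => (hφ.partialDeriv i).toL2)

variable (Ω)

/-- The subspace of pairs `(φ, ∇φ)` with `φ ∈ C_c^∞(Ω)`. -/
noncomputable def testJets : Submodule ℂ (JetSpace Ω) where
  carrier := {w | ∃ (φ : EuclideanSpace ℝ (Fin n) → ℂ) (hφ : IsTestFunction Ω φ), hφ.jet = w}
  zero_mem' := by
    refine ⟨0, .zero, ?_⟩
    have h : ∀ i : Fin n, partialDeriv i (0 : EuclideanSpace ℝ (Fin n) → ℂ) = 0 := by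
      intro i; ext x; simp [partialDeriv]
    simp only [IsTestFunction.jet, IsTestFunction.toL2, h]
    rfl
  add_mem' := by
    rintro _ _ ⟨φ, hφ, rfl⟩ ⟨ψ, hψ, rfl⟩
    refine ⟨φ + ψ, hφ.add hψ, ?_⟩
    simp only [IsTestFunction.jet, IsTestFunction.toL2,
      partialDeriv_add _ hφ.differentiable hψ.differentiable]
    rfl
  smul_mem' := by
    rintro c _ ⟨φ, hφ, rfl⟩
    refine ⟨c • φ, hφ.smul c, ?_⟩
    simp only [IsTestFunction.jet, IsTestFunction.toL2, partialDeriv_smul _ c hφ.differentiable]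
    rfl

/-- The pairs `(u, ∇u)` in the closure of the test functions. -/
noncomputable def sobolevJets : Submodule ℂ (JetSpace Ω) := (testJets Ω).topologicalClosure

/-- The Sobolev space `H¹₀(Ω)`, with the graph norm. -/
def sobolevH10 : Type := sobolevJets Ω

noncomputable instance : NormedAddCommGroup (sobolevH10 Ω) :=
  inferInstanceAs (NormedAddCommGroup (sobolevJets Ω))

noncomputable instance : InnerProductSpace ℂ (sobolevH10 Ω) :=
  inferInstanceAs (InnerProductSpace ℂ (sobolevJets Ω))

instance : CompleteSpace (sobolevH10 Ω) :=
  (Submodule.isClosed_topologicalClosure (testJets Ω)).completeSpace_coe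

variable {Ω}

theorem IsTestFunction.jet_mem {φ : EuclideanSpace ℝ (Fin n) → ℂ} (hφ : IsTestFunction Ω φ) :
    hφ.jet ∈ sobolevJets Ω :=
  Submodule.le_topologicalClosure _ ⟨φ, hφ, rfl⟩

/-- `∫_Ω u v = ⟪conj v, u⟫`, a continuous function of `u`. -/
theorem tendsto_integral_mul {μ : Measure (EuclideanSpace ℝ (Fin n))}
    {ι : Type*} {l : Filter ι} {u : ι → Lp ℂ 2 μ} {u₀ : Lp ℂ 2 μ}
    (hu : Tendsto u l (𝓝 u₀)) {v : EuclideanSpace ℝ (Fin n) → ℂ} (hv : MemLp v 2 μ) :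
    Tendsto (fun j => ∫ x, u j x * v x ∂μ) l (𝓝 (∫ x, u₀ x * v x ∂μ)) := by
  have hv' : MemLp (fun x => conj (v x)) 2 μ :=
    hv.of_le (Complex.continuous_conj.comp_aestronglyMeasurable hv.1) (by simp)
  have key : ∀ w : Lp ℂ 2 μ, ∫ x, w x * v x ∂μ = inner ℂ (hv'.toLp _) w := by
    intro w
    rw [L2.inner_def]
    refine integral_congr_ae ?_
    filter_upwards [hv'.coeFn_toLp] with x hx
    simp [hx]
  simp only [key]
  exact (tendsto_const_nhds (x := hv'.toLp _)).inner hu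

theorem IsTestFunction.integral_mul_partialDeriv {φ ψ : EuclideanSpace ℝ (Fin n) → ℂ}
    (hφ : IsTestFunction Ω φ) (hψ : IsTestFunction Ω ψ) (i : Fin n) :
    ∫ x in Ω, φ x * _root_.partialDeriv i ψ x = -∫ x in Ω, _root_.partialDeriv i φ x * ψ x := by
  rw [setIntegral_eq_integral_of_forall_compl_eq_zero fun x hx => by
      rw [hφ.eq_zero_of_notMem hx, zero_mul],
    setIntegral_eq_integral_of_forall_compl_eq_zero fun x hx => by
      rw [hψ.eq_zero_of_notMem hx, mul_zero]]
  exact integral_mul_fderiv_eq_neg_fderiv_mul_of_integrable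
    ((hψ.mul_left (hφ.partialDeriv i).contDiff).integrable volume)
    (((hψ.partialDeriv i).mul_left hφ.contDiff).integrable volume)
    ((hψ.mul_left hφ.contDiff).integrable volume)
    (fun x _ => hφ.differentiable x) (fun x _ => hψ.differentiable x)

/-- Integration by parts holds for test functions and survives `L²` limits, so the weak-gradient
identity is inherited by every point of the closure. Hilbert space arguments can therefore run on
`sobolevH10`. -/
theorem isH10WithGradient_iff {u : L2Space Ω} {G : Fin n → L2Space Ω} :
    IsH10WithGradient Ω u G ↔ (WithLp.toLp 2 (u, WithLp.toLp 2 G) : JetSpace Ω) ∈ sobolevJets Ω := by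
  constructor
  · rintro ⟨-, φ, hφ, hu, hG⟩
    rw [← IsTestFunction.tendsto_toL2_iff hφ] at hu
    refine mem_closure_of_tendsto (f := fun j => (hφ j).jet) (b := atTop) ?_
      (Eventually.of_forall fun j => ⟨φ j, hφ j, rfl⟩)
    have hG' : Tendsto (fun j i => ((hφ j).partialDeriv i).toL2) atTop (𝓝 G) :=
      tendsto_pi_nhds.2 fun i => (IsTestFunction.tendsto_toL2_iff _ _).2 (hG i)
    exact ((WithLp.prod_continuous_toLp 2 _ _).tendsto (u, WithLp.toLp 2 G)).comp
      (hu.prodMk_nhds (((PiLp.continuous_toLp 2 _).tendsto G).comp hG'))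
  · intro h
    obtain ⟨w, hw, hlim⟩ := mem_closure_iff_seq_limit.1 h
    choose φ hφ hjet using hw
    have hu : Tendsto (fun j => (hφ j).toL2) atTop (𝓝 u) := by
      have := ((WithLp.fstL 2 ℂ (L2Space Ω) (PiLp 2 fun _ : Fin n => L2Space Ω)).continuous.tendsto
        _).comp hlim
      refine this.congr fun j => ?_
      rw [Function.comp_apply, ← hjet j]
      rfl
    have hG : ∀ i, Tendsto (fun j => ((hφ j).partialDeriv i).toL2) atTop (𝓝 (G i)) := by
      intro i
      have := (((PiLp.proj 2 (𝕜 := ℂ) (fun _ : Fin n => L2Space Ω) i).comp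
        (WithLp.sndL 2 ℂ (L2Space Ω) (PiLp 2 fun _ : Fin n => L2Space Ω))).continuous.tendsto
        _).comp hlim
      refine this.congr fun j => ?_
      rw [Function.comp_apply, ← hjet j]
      rfl
    refine ⟨fun i ψ hψ => ?_, φ, hφ, (IsTestFunction.tendsto_toL2_iff hφ u).1 hu,
      fun i => (IsTestFunction.tendsto_toL2_iff (fun j => (hφ j).partialDeriv i) _).1 (hG i)⟩
    refine tendsto_nhds_unique (tendsto_integral_mul hu ((hψ.partialDeriv i).memLp 2 _))
      (((tendsto_integral_mul (hG i) (hψ.memLp 2 _)).neg).congr fun j => ?_)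
    have h1 : ∫ x in Ω, (hφ j).toL2 x * partialDeriv i ψ x
        = ∫ x in Ω, φ j x * partialDeriv i ψ x :=
      integral_congr_ae (by filter_upwards [(hφ j).coeFn_toL2] with x hx; rw [hx])
    have h2 : ∫ x in Ω, ((hφ j).partialDeriv i).toL2 x * ψ x
        = ∫ x in Ω, partialDeriv i (φ j) x * ψ x :=
      integral_congr_ae (by filter_upwards [((hφ j).partialDeriv i).coeFn_toL2] with x hx; rw [hx])
    rw [h1, h2, (hφ j).integral_mul_partialDeriv hψ]

namespace sobolevH10

/-- The embedding `H¹₀(Ω) → L²(Ω)`. -/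
noncomputable def val : sobolevH10 Ω →L[ℂ] L2Space Ω :=
  (WithLp.fstL 2 ℂ (L2Space Ω) (PiLp 2 fun _ : Fin n => L2Space Ω)).comp (sobolevJets Ω).subtypeL

/-- The weak derivative `∂ᵢ : H¹₀(Ω) → L²(Ω)`. -/
noncomputable def grad (i : Fin n) : sobolevH10 Ω →L[ℂ] L2Space Ω :=
  ((PiLp.proj 2 (𝕜 := ℂ) (fun _ : Fin n => L2Space Ω) i).comp
    (WithLp.sndL 2 ℂ (L2Space Ω) (PiLp 2 fun _ : Fin n => L2Space Ω))).comp (sobolevJets Ω).subtypeL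

theorem norm_sq_eq (w : sobolevH10 Ω) :
    ‖w‖ ^ 2 = ‖val w‖ ^ 2 + ∑ i, ‖grad i w‖ ^ 2 := by
  change ‖(w.1 : JetSpace Ω)‖ ^ 2 = _
  rw [WithLp.prod_norm_sq_eq_of_L2, PiLp.norm_sq_eq_of_L2]
  rfl

theorem isH10WithGradient (w : sobolevH10 Ω) :
    IsH10WithGradient Ω (val w) (fun i => grad i w) :=
  isH10WithGradient_iff.2 w.2

/-- The element of `H¹₀(Ω)` given by a function and its weak gradient. -/
noncomputable def ofGradient {u : L2Space Ω} {G : Fin n → L2Space Ω}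
    (h : IsH10WithGradient Ω u G) : sobolevH10 Ω :=
  ⟨_, isH10WithGradient_iff.1 h⟩

/-- A test function as an element of `H¹₀(Ω)`. -/
noncomputable def ofTest {φ : EuclideanSpace ℝ (Fin n) → ℂ} (hφ : IsTestFunction Ω φ) :
    sobolevH10 Ω := ⟨hφ.jet, hφ.jet_mem⟩

@[simp] theorem val_ofTest {φ : EuclideanSpace ℝ (Fin n) → ℂ} (hφ : IsTestFunction Ω φ) :
    val (ofTest hφ) = hφ.toL2 := rfl

@[simp] theorem grad_ofTest {φ : EuclideanSpace ℝ (Fin n) → ℂ} (hφ : IsTestFunction Ω φ)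
    (i : Fin n) : grad i (ofTest hφ) = (hφ.partialDeriv i).toL2 := rfl

/-- A closed property that holds for test functions holds on `H¹₀(Ω)`. -/
theorem induction {p : sobolevH10 Ω → Prop} (hp : IsClosed {w | p w})
    (h : ∀ (φ : EuclideanSpace ℝ (Fin n) → ℂ) (hφ : IsTestFunction Ω φ), p (ofTest hφ))
    (w : sobolevH10 Ω) : p w := by
  obtain ⟨z, hz, hlim⟩ := mem_closure_iff_seq_limit.1 w.2
  choose φ hφ hjet using hz
  refine hp.mem_of_tendsto (f := fun j => ofTest (hφ j)) (b := atTop)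
    (tendsto_subtype_rng.2 (hlim.congr fun j => (hjet j).symm)) (Eventually.of_forall fun j => h _ _)

end sobolevH10

/-- An element of `L²(Ω)` orthogonal to all test functions vanishes. -/
theorem eq_zero_of_forall_inner_toL2 (hΩ : IsOpen Ω) (hb : volume Ω ≠ ⊤) (u : L2Space Ω)
    (h : ∀ (φ : EuclideanSpace ℝ (Fin n) → ℂ) (hφ : IsTestFunction Ω φ),
      inner ℂ hφ.toL2 u = 0) : u = 0 := by
  have : IsFiniteMeasure (volume.restrict Ω) := ⟨by simpa using hb.lt_top⟩
  have hint : IntegrableOn (fun x => u x) Ω := (Lp.memLp u).integrable (by norm_num)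
  have := hΩ.ae_eq_zero_of_integral_contDiff_smul_eq_zero (μ := volume)
    hint.locallyIntegrableOn (fun g hg hc ht => ?_)
  · rw [Lp.eq_zero_iff_ae_eq_zero]
    exact (ae_restrict_iff' hΩ.measurableSet).2 this
  have ht' : tsupport (fun x => (g x : ℂ)) ⊆ Ω :=
    (closure_mono fun x hx => by simpa using hx).trans ht
  have hφ : IsTestFunction Ω (fun x => (g x : ℂ)) :=
    ⟨Complex.ofRealCLM.contDiff.comp hg, hc.comp_left (g := fun t : ℝ => (t : ℂ)) (by simp), ht'⟩
  rw [← h _ hφ, L2.inner_def,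
    ← setIntegral_eq_integral_of_forall_compl_eq_zero (s := Ω) fun x hx => by
      have := hφ.eq_zero_of_notMem hx
      simp_all]
  refine integral_congr_ae ?_
  filter_upwards [hφ.coeFn_toL2] with x hx
  rw [hx, RCLike.inner_apply, Complex.conj_ofReal, Complex.real_smul, mul_comm]

/-- Test functions are dense in `L²(Ω)`. -/
theorem induction_toL2 (hΩ : IsOpen Ω) (hb : volume Ω ≠ ⊤) {p : L2Space Ω → Prop}
    (hp : IsClosed {u | p u})
    (h : ∀ (φ : EuclideanSpace ℝ (Fin n) → ℂ) (hφ : IsTestFunction Ω φ), p hφ.toL2)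
    (u : L2Space Ω) : p u := by
  have hd : (LinearMap.range (sobolevH10.val (Ω := Ω)).toLinearMap).topologicalClosure = ⊤ := by
    rw [Submodule.topologicalClosure_eq_top_iff, Submodule.eq_bot_iff]
    intro v hv
    exact eq_zero_of_forall_inner_toL2 hΩ hb v fun φ hφ =>
      (Submodule.mem_orthogonal _ _).1 hv _ ⟨sobolevH10.ofTest hφ, rfl⟩
  have hu : u ∈ closure (Set.range (sobolevH10.val (Ω := Ω))) := by
    have : u ∈ (LinearMap.range (sobolevH10.val (Ω := Ω)).toLinearMap).topologicalClosure := by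
      rw [hd]; trivial
    exact this
  refine closure_minimal ?_ hp hu
  rintro _ ⟨w, rfl⟩
  exact sobolevH10.induction (p := fun w => p (sobolevH10.val w))
    (hp.preimage sobolevH10.val.continuous) (fun φ hφ => h φ hφ) w

end SobolevSpace

/-! ### Plane waves and the Fourier transform on `L²(Ω)` -/

section PlaneWave

open scoped FourierTransform RealInnerProductSpace

variable {n : ℕ} {Ω : Set (EuclideanSpace ℝ (Fin n))}

theorem Bornology.IsBounded.isFiniteMeasure_restrict (hb : Bornology.IsBounded Ω) :
    IsFiniteMeasure (volume.restrict Ω) :=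
  ⟨by simpa using hb.measure_lt_top⟩

theorem memLp_fourierChar (hb : Bornology.IsBounded Ω) (ξ : EuclideanSpace ℝ (Fin n)) :
    MemLp (fun x => (𝐞 ⟪x, ξ⟫ : ℂ)) 2 (volume.restrict Ω) := by
  have := hb.isFiniteMeasure_restrict
  have hc : Continuous (fun x : EuclideanSpace ℝ (Fin n) => (𝐞 ⟪x, ξ⟫ : ℂ)) :=
    by simp only [Real.fourierChar_apply]; fun_prop
  exact MemLp.of_bound hc.aestronglyMeasurable 1
    (Eventually.of_forall fun x => (Circle.norm_coe _).le)

/-- The plane wave `x ↦ exp(2πi x·ξ)` in `L²(Ω)`. -/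
noncomputable def planeWave (hb : Bornology.IsBounded Ω) (ξ : EuclideanSpace ℝ (Fin n)) :
    L2Space Ω := (memLp_fourierChar hb ξ).toLp _

theorem coeFn_planeWave (hb : Bornology.IsBounded Ω) (ξ : EuclideanSpace ℝ (Fin n)) :
    planeWave hb ξ =ᵐ[volume.restrict Ω] fun x => (𝐞 ⟪x, ξ⟫ : ℂ) :=
  (memLp_fourierChar hb ξ).coeFn_toLp

theorem L2_norm_sq_eq_integral {α : Type*} [MeasurableSpace α] {μ : Measure α} (u : Lp ℂ 2 μ) :
    ‖u‖ ^ 2 = ∫ x, ‖u x‖ ^ 2 ∂μ := by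
  have h := L2.inner_def (𝕜 := ℂ) u u
  simp only [inner_self_eq_norm_sq_to_K] at h
  have h' : ((‖u‖ ^ 2 : ℝ) : ℂ) = ((∫ x, ‖u x‖ ^ 2 ∂μ : ℝ) : ℂ) := by
    rw [← integral_complex_ofReal]
    simpa using h
  exact_mod_cast h'

/-- The frequency-independent norm is the source of the factor `V_Ω` in the upper bound. -/
theorem norm_planeWave_sq (hb : Bornology.IsBounded Ω) (ξ : EuclideanSpace ℝ (Fin n)) :
    ‖planeWave hb ξ‖ ^ 2 = volume.real Ω := by
  have h : ∫ x in Ω, ‖planeWave hb ξ x‖ ^ 2 = ∫ x in Ω, (1 : ℝ) :=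
    integral_congr_ae (by filter_upwards [coeFn_planeWave hb ξ] with x hx; rw [hx, Circle.norm_coe, one_pow])
  rw [L2_norm_sq_eq_integral, h]
  simp

/-- On a bounded set the phases vary by at most `2π|x||ξ - η|`, so the map is even Lipschitz. This
gives measurability in `ξ` and, for Rellich, compactness of the plane waves of bounded frequency. -/
theorem continuous_planeWave (hb : Bornology.IsBounded Ω) : Continuous (planeWave hb) := by
  have := hb.isFiniteMeasure_restrict
  obtain ⟨r, hr⟩ := hb.subset_closedBall 0
  have hr' : ∀ x ∈ Ω, ‖x‖ ≤ max r 0 := fun x hx => le_max_of_le_left (by simpa using hr hx)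
  set K : ℝ := (measureUnivNNReal (volume.restrict Ω) : ℝ) ^ (2 : ℝ≥0∞).toReal⁻¹
  refine (LipschitzWith.of_dist_le_mul (K := (K * (2 * Real.pi * max r 0)).toNNReal)
    fun ξ η => ?_).continuous
  rw [Real.coe_toNNReal _ (by positivity), mul_assoc K, dist_eq_norm, dist_eq_norm]
  refine Lp.norm_le_of_ae_bound (by positivity) ?_
  have hΩ' : ∀ᵐ x ∂volume.restrict Ω, ‖x‖ ≤ max r 0 :=
    (ae_restrict_iff (measurableSet_le (by fun_prop) (by fun_prop))).2 (Eventually.of_forall hr')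
  filter_upwards [coeFn_planeWave hb ξ, coeFn_planeWave hb η,
    Lp.coeFn_sub (planeWave hb ξ) (planeWave hb η), hΩ'] with x h1 h2 h3 hx
  rw [h3, Pi.sub_apply, h1, h2]
  have : ‖(𝐞 ⟪x, ξ⟫ : ℂ) - 𝐞 ⟪x, η⟫‖ ≤ 2 * Real.pi * |⟪x, ξ - η⟫| := by
    rw [Real.fourierChar_apply, Real.fourierChar_apply]
    have h4 : Complex.exp (↑(2 * Real.pi * ⟪x, ξ⟫) * Complex.I)
        - Complex.exp (↑(2 * Real.pi * ⟪x, η⟫) * Complex.I)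
        = Complex.exp (↑(2 * Real.pi * ⟪x, η⟫) * Complex.I) *
          (Complex.exp (Complex.I * ↑(2 * Real.pi * ⟪x, ξ - η⟫)) - 1) := by
      rw [mul_sub, ← Complex.exp_add, inner_sub_right]
      push_cast
      ring_nf
    rw [h4, norm_mul, Complex.norm_exp_ofReal_mul_I, one_mul]
    refine Real.norm_exp_I_mul_ofReal_sub_one_le.trans ?_
    rw [Real.norm_eq_abs, abs_mul, abs_of_pos Real.two_pi_pos]
  refine this.trans ?_
  rw [mul_assoc (2 * Real.pi)]
  gcongr
  exact (abs_real_inner_le_norm _ _).trans (by gcongr)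

/-- The inner product with a plane wave serves as the Fourier transform on all of `L²(Ω)`. It is
identified with `𝓕` only on test functions, where Plancherel for Schwartz functions applies; the
rest follows by density. -/
theorem IsTestFunction.inner_planeWave_toL2 (hb : Bornology.IsBounded Ω)
    {φ : EuclideanSpace ℝ (Fin n) → ℂ} (hφ : IsTestFunction Ω φ) (ξ : EuclideanSpace ℝ (Fin n)) :
    inner ℂ (planeWave hb ξ) hφ.toL2 = 𝓕 φ ξ := by
  rw [L2.inner_def, Real.fourier_eq,
    ← setIntegral_eq_integral_of_forall_compl_eq_zero (s := Ω)
      (f := fun x => 𝐞 (-⟪x, ξ⟫) • φ x) fun x hx => by rw [hφ.eq_zero_of_notMem hx, smul_zero]]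
  refine integral_congr_ae ?_
  filter_upwards [coeFn_planeWave hb ξ, hφ.coeFn_toL2] with x h1 h2
  rw [h1, h2, RCLike.inner_apply, ← Circle.coe_inv_eq_conj, ← AddChar.map_neg_eq_inv,
    Circle.smul_def, smul_eq_mul, mul_comm]

theorem IsTestFunction.norm_toL2_sq {φ : EuclideanSpace ℝ (Fin n) → ℂ}
    (hφ : IsTestFunction Ω φ) : ‖hφ.toL2‖ ^ 2 = ∫ x, ‖φ x‖ ^ 2 := by
  rw [L2_norm_sq_eq_integral,
    ← setIntegral_eq_integral_of_forall_compl_eq_zero (s := Ω) (f := fun x => ‖φ x‖ ^ 2)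
      fun x hx => by rw [hφ.eq_zero_of_notMem hx]; simp]
  exact integral_congr_ae (by filter_upwards [hφ.coeFn_toL2] with x hx; rw [hx])

theorem IsTestFunction.integral_norm_sq_fourier {φ : EuclideanSpace ℝ (Fin n) → ℂ}
    (hφ : IsTestFunction Ω φ) : ∫ ξ, ‖𝓕 φ ξ‖ ^ 2 = ‖hφ.toL2‖ ^ 2 := by
  have := (hφ.hasCompactSupport.toSchwartzMap hφ.contDiff).integral_norm_sq_fourier
  rw [SchwartzMap.fourier_coe] at this
  exact this.trans hφ.norm_toL2_sq.symm

theorem IsTestFunction.integrable_norm_sq_fourier {φ : EuclideanSpace ℝ (Fin n) → ℂ}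
    (hφ : IsTestFunction Ω φ) : Integrable fun ξ => ‖𝓕 φ ξ‖ ^ 2 := by
  have := (𝓕 (hφ.hasCompactSupport.toSchwartzMap hφ.contDiff)).memLp 2 volume
  rw [SchwartzMap.fourier_coe] at this
  exact this.integrable_norm_pow (by norm_num)

theorem IsTestFunction.fourier_partialDeriv {φ : EuclideanSpace ℝ (Fin n) → ℂ}
    (hφ : IsTestFunction Ω φ) (i : Fin n) (ξ : EuclideanSpace ℝ (Fin n)) :
    𝓕 (_root_.partialDeriv i φ) ξ = 2 * Real.pi * Complex.I * ξ i * 𝓕 φ ξ := by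
  have h := SchwartzMap.fourier_lineDerivOp_eq (hφ.hasCompactSupport.toSchwartzMap hφ.contDiff)
    (EuclideanSpace.single i (1 : ℝ))
  have h2 := DFunLike.congr_fun h ξ
  rw [SchwartzMap.fourier_coe, smul_apply,
    SchwartzMap.smulLeftCLM_apply_apply (by fun_prop), SchwartzMap.fourier_coe] at h2
  have h3 : ⇑(LineDeriv.lineDerivOp (EuclideanSpace.single i (1 : ℝ))
      (hφ.hasCompactSupport.toSchwartzMap hφ.contDiff)) = _root_.partialDeriv i φ := by
    ext x
    rw [SchwartzMap.lineDerivOp_apply_eq_fderiv]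
    rfl
  rw [h3] at h2
  have h4 : ⇑(hφ.hasCompactSupport.toSchwartzMap hφ.contDiff) = φ := rfl
  rw [h2, h4]
  simp [EuclideanSpace.inner_single_right, mul_assoc]

theorem IsTestFunction.norm_sq_fourier_partialDeriv_sum {φ : EuclideanSpace ℝ (Fin n) → ℂ}
    (hφ : IsTestFunction Ω φ) (ξ : EuclideanSpace ℝ (Fin n)) :
    ∑ i, ‖𝓕 (_root_.partialDeriv i φ) ξ‖ ^ 2 = 4 * Real.pi ^ 2 * ‖ξ‖ ^ 2 * ‖𝓕 φ ξ‖ ^ 2 := by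
  simp only [hφ.fourier_partialDeriv, norm_mul, mul_pow]
  rw [← Finset.sum_mul, EuclideanSpace.norm_sq_eq, Finset.mul_sum]
  simp [abs_of_pos Real.pi_pos]
  left
  ring_nf

/-- The weighted square integral of `û` is continuous in `u ∈ L²(Ω)`. -/
theorem continuous_integral_norm_sq_inner_planeWave (hb : Bornology.IsBounded Ω)
    {ν : Measure (EuclideanSpace ℝ (Fin n))} {m : EuclideanSpace ℝ (Fin n) → ℝ}
    (hm : Integrable m ν) :
    Continuous fun u : L2Space Ω => ∫ ξ, m ξ * ‖(inner ℂ (planeWave hb ξ) u : ℂ)‖ ^ 2 ∂ν := by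
  refine continuous_iff_continuousAt.2 fun u₀ => ?_
  refine continuousAt_of_dominated (bound := fun ξ => |m ξ| * (volume.real Ω * (‖u₀‖ + 1) ^ 2))
    (Eventually.of_forall fun u => hm.1.mul ?_) ?_ (hm.abs.mul_const _)
    (Eventually.of_forall fun ξ => by fun_prop)
  · exact (((continuous_planeWave hb).inner continuous_const).norm.pow 2).aestronglyMeasurable
  · filter_upwards [Metric.ball_mem_nhds u₀ one_pos] with u hu
    refine Eventually.of_forall fun ξ => ?_
    rw [norm_mul, Real.norm_eq_abs, norm_pow, norm_norm]
    gcongr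
    have hu' : ‖u‖ ≤ ‖u₀‖ + 1 := by
      have := norm_le_norm_add_norm_sub' u u₀
      rw [← dist_eq_norm] at this
      linarith [Metric.mem_ball.1 hu]
    calc ‖(inner ℂ (planeWave hb ξ) u : ℂ)‖ ^ 2 ≤ (‖planeWave hb ξ‖ * ‖u‖) ^ 2 := by
          gcongr; exact norm_inner_le_norm _ _
      _ = volume.real Ω * ‖u‖ ^ 2 := by rw [mul_pow, norm_planeWave_sq]
      _ ≤ _ := by gcongr

/-- Bessel's inequality for plane waves. -/
theorem setIntegral_norm_sq_inner_planeWave_le (hΩ : IsOpen Ω) (hb : Bornology.IsBounded Ω)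
    {s : Set (EuclideanSpace ℝ (Fin n))} (hs : volume s ≠ ⊤) (u : L2Space Ω) :
    ∫ ξ in s, ‖(inner ℂ (planeWave hb ξ) u : ℂ)‖ ^ 2 ≤ ‖u‖ ^ 2 := by
  have hm : Integrable (fun _ => (1 : ℝ)) (volume.restrict s) := by
    have : IsFiniteMeasure (volume.restrict s) := ⟨by simpa using hs.lt_top⟩
    exact integrable_const _
  have hc := continuous_integral_norm_sq_inner_planeWave hb hm
  simp only [one_mul] at hc
  refine induction_toL2 hΩ hb.measure_lt_top.ne
    (p := fun u => ∫ ξ in s, ‖(inner ℂ (planeWave hb ξ) u : ℂ)‖ ^ 2 ≤ ‖u‖ ^ 2)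
    (isClosed_le hc (by fun_prop)) (fun φ hφ => ?_) u
  simp only [hφ.inner_planeWave_toL2, ← hφ.integral_norm_sq_fourier]
  exact setIntegral_le_integral hφ.integrable_norm_sq_fourier
    (Eventually.of_forall fun ξ => by positivity)

/-- The function `ξ ↦ (M - 4π²|ξ|²)₊`. -/
noncomputable def weylSymbol (M : ℝ) (ξ : EuclideanSpace ℝ (Fin n)) : ℝ :=
  max (M - 4 * Real.pi ^ 2 * ‖ξ‖ ^ 2) 0

theorem weylSymbol_nonneg (M : ℝ) (ξ : EuclideanSpace ℝ (Fin n)) : 0 ≤ weylSymbol M ξ :=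
  le_max_right _ _

theorem continuous_weylSymbol (M : ℝ) :
    Continuous (weylSymbol M : EuclideanSpace ℝ (Fin n) → ℝ) := by
  unfold weylSymbol
  fun_prop

theorem weylSymbol_le (M : ℝ) (ξ : EuclideanSpace ℝ (Fin n)) : weylSymbol M ξ ≤ max M 0 :=
  max_le_max_right 0 (by have := Real.pi_pos; nlinarith [sq_nonneg (Real.pi * ‖ξ‖)])

theorem weylSymbol_eq_zero {M : ℝ} {ξ : EuclideanSpace ℝ (Fin n)}
    (h : √M / (2 * Real.pi) ≤ ‖ξ‖) : weylSymbol M ξ = 0 := by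
  refine max_eq_right ?_
  rw [div_le_iff₀ Real.two_pi_pos, Real.sqrt_le_left (by positivity)] at h
  linarith [h]

theorem weylSymbol_eq_sub {M : ℝ} (hM : 0 ≤ M) {ξ : EuclideanSpace ℝ (Fin n)}
    (h : ‖ξ‖ ≤ √M / (2 * Real.pi)) : weylSymbol M ξ = M - 4 * Real.pi ^ 2 * ‖ξ‖ ^ 2 := by
  refine max_eq_left ?_
  rw [le_div_iff₀ Real.two_pi_pos, Real.le_sqrt (by positivity) hM] at h
  linarith [h]

theorem integrable_weylSymbol (M : ℝ) :
    Integrable (weylSymbol M : EuclideanSpace ℝ (Fin n) → ℝ) := by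
  refine (continuous_weylSymbol M).integrable_of_hasCompactSupport
    (HasCompactSupport.intro (isCompact_closedBall 0 (√M / (2 * Real.pi))) fun ξ hξ => ?_)
  rw [mem_closedBall_zero_iff, not_le] at hξ
  exact weylSymbol_eq_zero hξ.le

/-- The kinetic energy of `u ∈ H¹₀(Ω)` in Fourier variables. -/
theorem mul_norm_sq_sub_grad_le (hb : Bornology.IsBounded Ω) (M : ℝ) (w : sobolevH10 Ω) :
    M * ‖sobolevH10.val w‖ ^ 2 - ∑ i, ‖sobolevH10.grad i w‖ ^ 2 ≤
      ∫ ξ, weylSymbol M ξ * ‖(inner ℂ (planeWave hb ξ) (sobolevH10.val w) : ℂ)‖ ^ 2 := by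
  have hc := continuous_integral_norm_sq_inner_planeWave hb
    (integrable_weylSymbol (n := n) M)
  -- Both sides are continuous in the graph norm. On test functions Plancherel turns the left side
  -- into `∫ (M - 4π²|ξ|²)|𝓕 φ|²`, and passing to the positive part only increases it.
  refine sobolevH10.induction (p := fun w => M * ‖sobolevH10.val w‖ ^ 2
      - ∑ i, ‖sobolevH10.grad i w‖ ^ 2 ≤
      ∫ ξ, weylSymbol M ξ * ‖(inner ℂ (planeWave hb ξ) (sobolevH10.val w) : ℂ)‖ ^ 2)
    (isClosed_le (by fun_prop) (hc.comp sobolevH10.val.continuous)) (fun φ hφ => ?_) w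
  simp only [sobolevH10.val_ofTest, sobolevH10.grad_ofTest, hφ.inner_planeWave_toL2,
    ← IsTestFunction.integral_norm_sq_fourier]
  rw [← integral_finsetSum _ fun i _ => (hφ.partialDeriv i).integrable_norm_sq_fourier,
    ← integral_const_mul, ← integral_sub (hφ.integrable_norm_sq_fourier.const_mul _)
      (integrable_finsetSum _ fun i _ => (hφ.partialDeriv i).integrable_norm_sq_fourier)]
  refine integral_mono ((hφ.integrable_norm_sq_fourier.const_mul _).sub
      (integrable_finsetSum _ fun i _ => (hφ.partialDeriv i).integrable_norm_sq_fourier))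
    (hφ.integrable_norm_sq_fourier.bdd_mul (c := max M 0)
      (continuous_weylSymbol M).aestronglyMeasurable (Eventually.of_forall fun ξ => ?_))
    fun ξ => ?_
  · rw [Real.norm_eq_abs, abs_of_nonneg (weylSymbol_nonneg _ _)]
    exact weylSymbol_le M ξ
  · simp only [hφ.norm_sq_fourier_partialDeriv_sum, ← sub_mul]
    gcongr
    exact le_max_left _ _

end PlaneWave

/-! ### Potentials in `L^{n/2}` are infinitesimally form-bounded -/

section FormBound

variable {n : ℕ} {Ω : Set (EuclideanSpace ℝ (Fin n))}

/-- Cauchy–Schwarz in coordinates. It converts a Sobolev bound in terms of `fderiv` into one in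
terms of the partial derivatives. -/
theorem norm_fderiv_sq_le_sum_partialDeriv (φ : EuclideanSpace ℝ (Fin n) → ℂ)
    (x : EuclideanSpace ℝ (Fin n)) :
    ‖fderiv ℝ φ x‖ ^ 2 ≤ ∑ i, ‖partialDeriv i φ x‖ ^ 2 := by
  have h : ‖fderiv ℝ φ x‖ ≤ √(∑ i, ‖partialDeriv i φ x‖ ^ 2) := by
    refine ContinuousLinearMap.opNorm_le_bound _ (Real.sqrt_nonneg _) fun v => ?_
    have hv : v = ∑ i, v i • EuclideanSpace.single i (1 : ℝ) := by
      conv_lhs => rw [← (EuclideanSpace.basisFun (Fin n) ℝ).sum_repr v]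
      simp
    conv_lhs => rw [hv, map_sum]
    refine (norm_sum_le _ _).trans ?_
    simp only [map_smul, norm_smul]
    rw [EuclideanSpace.norm_eq, mul_comm]
    exact Real.sum_mul_le_sqrt_mul_sqrt _ _ _
  calc ‖fderiv ℝ φ x‖ ^ 2 ≤ √(∑ i, ‖partialDeriv i φ x‖ ^ 2) ^ 2 := by gcongr
    _ = _ := Real.sq_sqrt (Finset.sum_nonneg fun i _ => by positivity)

theorem IsTestFunction.lintegral_enorm_sq {φ : EuclideanSpace ℝ (Fin n) → ℂ}
    (hφ : IsTestFunction Ω φ) : ∫⁻ x, ‖φ x‖ₑ ^ 2 = ENNReal.ofReal (‖hφ.toL2‖ ^ 2) := by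
  rw [hφ.norm_toL2_sq, ofReal_integral_eq_lintegral_ofReal
    ((hφ.memLp 2 volume).integrable_norm_pow (by norm_num))
    (Eventually.of_forall fun x => by positivity)]
  refine lintegral_congr fun x => ?_
  rw [ENNReal.ofReal_pow (norm_nonneg _), ofReal_norm]

/-- The Sobolev inequality for test functions. -/
theorem IsTestFunction.exists_sobolev_const (hn : 3 ≤ n) :
    ∃ S : NNReal, ∀ (φ : EuclideanSpace ℝ (Fin n) → ℂ) (hφ : IsTestFunction Ω φ),
      (∫⁻ x, (‖φ x‖ₑ ^ 2) ^ ((n : ℝ) / (n - 2))) ^ (1 / ((n : ℝ) / (n - 2))) ≤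
        S * ENNReal.ofReal (∑ i, ‖(hφ.partialDeriv i).toL2‖ ^ 2) := by
  have hn' : (3 : ℝ) ≤ n := by exact_mod_cast hn
  have hn2 : (0 : ℝ) < n - 2 := by linarith
  set S := SNormLESNormFDerivOfEqConst ℂ
    (volume : Measure (EuclideanSpace ℝ (Fin n))) ((2 : NNReal) : ℝ)
  refine ⟨S ^ 2, fun φ hφ => ?_⟩
  -- `2n/(n-2)` is the Sobolev conjugate of 2. Squaring turns the `L^{p'}` norm of `φ` into the
  -- `L^{n/(n-2)}` norm of `|φ|²`, which is Hölder dual to `L^{n/2}`.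
  have hp0 : 0 < 2 * (n : ℝ) / (n - 2) := by positivity
  obtain ⟨p', hp'⟩ : ∃ p' : NNReal, (p' : ℝ) = 2 * (n : ℝ) / (n - 2) := ⟨⟨_, hp0.le⟩, rfl⟩
  have hp'0 : p' ≠ 0 := by
    rw [← NNReal.coe_ne_zero, hp']; exact hp0.ne'
  have h := eLpNorm_le_eLpNorm_fderiv_of_eq (volume : Measure (EuclideanSpace ℝ (Fin n)))
    (hφ.contDiff.of_le (by simp)) hφ.hasCompactSupport
    (p := 2) (p' := p') (by norm_num) (by simp; lia) (by
      simp only [hp', finrank_euclideanSpace, Fintype.card_fin]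
      push_cast
      field_simp)
  rw [eLpNorm_nnreal_eq_lintegral hp'0] at h
  have h1 : ∫⁻ x, (‖φ x‖ₑ ^ 2) ^ ((n : ℝ) / (n - 2)) = ∫⁻ x, ‖φ x‖ₑ ^ (p' : ℝ) := by
    refine lintegral_congr fun x => ?_
    rw [← ENNReal.rpow_natCast, ← ENNReal.rpow_mul]
    congr 1
    rw [hp']
    push_cast
    ring
  have h2 : (1 : ℝ) / ((n : ℝ) / (n - 2)) = 1 / (p' : ℝ) * (2 : ℕ) := by
    rw [hp']
    push_cast
    field_simp
  rw [h1, h2, ENNReal.rpow_mul, ENNReal.rpow_natCast]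
  refine (pow_le_pow_left' h 2).trans ?_
  rw [mul_pow, ENNReal.coe_pow]
  refine mul_le_mul' le_rfl ?_
  have h3 : eLpNorm (fderiv ℝ φ) (2 : NNReal) volume ^ 2 = ∫⁻ x, ‖fderiv ℝ φ x‖ₑ ^ 2 := by
    rw [eLpNorm_nnreal_eq_lintegral (by norm_num), ← ENNReal.rpow_natCast, ← ENNReal.rpow_mul]
    simp
  have h4 : ENNReal.ofReal (∑ i, ‖(hφ.partialDeriv i).toL2‖ ^ 2)
      = ∫⁻ x, ∑ i, ‖_root_.partialDeriv i φ x‖ₑ ^ 2 := by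
    rw [lintegral_finsetSum _ fun i _ => by
        have := (hφ.partialDeriv i).continuous
        fun_prop,
      ENNReal.ofReal_sum_of_nonneg fun i _ => by positivity]
    exact Finset.sum_congr rfl fun i _ => (hφ.partialDeriv i).lintegral_enorm_sq.symm
  rw [h3, h4]
  refine lintegral_mono fun x => ?_
  simp only [← ofReal_norm, ← ENNReal.ofReal_pow (norm_nonneg _)]
  rw [← ENNReal.ofReal_sum_of_nonneg fun i _ => by positivity]
  exact ENNReal.ofReal_le_ofReal (norm_fderiv_sq_le_sum_partialDeriv φ x)

theorem Lp_norm_sq_eq_lintegral {α : Type*} [MeasurableSpace α] {μ : Measure α} (u : Lp ℂ 2 μ) :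
    ENNReal.ofReal (‖u‖ ^ 2) = ∫⁻ x, ‖u x‖ₑ ^ 2 ∂μ := by
  rw [L2_norm_sq_eq_integral, ofReal_integral_eq_lintegral_ofReal
    ((Lp.memLp u).integrable_norm_pow (by norm_num)) (Eventually.of_forall fun x => by positivity)]
  refine lintegral_congr fun x => ?_
  rw [ENNReal.ofReal_pow (norm_nonneg _), ofReal_norm]

/-- `|q|` is form-bounded by the Laplacian with relative bound zero. -/
theorem exists_lintegral_potential_le (hn : 3 ≤ n) {q : EuclideanSpace ℝ (Fin n) → ℝ}
    (hq : MemLp q ((n : ℝ≥0∞) / 2) (volume.restrict Ω)) {ε : ℝ} (hε : 0 < ε) :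
    ∃ C : ℝ, 0 < C ∧ ∀ w : sobolevH10 Ω,
      ∫⁻ x in Ω, ‖q x‖ₑ * ‖sobolevH10.val w x‖ₑ ^ 2 ≤
        ENNReal.ofReal (ε * ∑ i, ‖sobolevH10.grad i w‖ ^ 2 + C * ‖sobolevH10.val w‖ ^ 2) := by
  have hn' : (3 : ℝ) ≤ n := by exact_mod_cast hn
  have hn2 : (0 : ℝ) < n - 2 := by linarith
  obtain ⟨S, hS⟩ := IsTestFunction.exists_sobolev_const (Ω := Ω) hn
  -- The level `M` makes the `L^{n/2}` norm of `q` on `{|q| ≥ M}` at most `ε/(S+1)`, which times the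
  -- Sobolev constant `S` is at most `ε`; the `+ 1` covers `S = 0`. Below the level `|q| ≤ M`, so
  -- `M` serves as `C`.
  have hδ : 0 < ε / (S + 1) := by positivity
  obtain ⟨M, hM0, hM⟩ := (hq.ae_eq hq.1.ae_eq_mk).eLpNorm_indicator_norm_ge_pos_le
    hq.1.stronglyMeasurable_mk hδ
  set q' := hq.1.mk q with hq'
  have hqq : q =ᵐ[volume.restrict Ω] q' := hq.1.ae_eq_mk
  have hq'm : Measurable q' := hq.1.stronglyMeasurable_mk.measurable
  refine ⟨M, hM0, fun w => ?_⟩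
  refine sobolevH10.induction (p := fun w => ∫⁻ x in Ω, ‖q x‖ₑ * ‖sobolevH10.val w x‖ₑ ^ 2 ≤
    ENNReal.ofReal (ε * ∑ i, ‖sobolevH10.grad i w‖ ^ 2 + M * ‖sobolevH10.val w‖ ^ 2))
    ?_ (fun φ hφ => ?_) w
  -- Finiteness of the potential energy of the limit is part of the claim, so the bound passes to it
  -- by Fatou's lemma along an a.e. convergent subsequence.
  · refine IsSeqClosed.isClosed fun z z₀ hz hlim => ?_
    have hv : Tendsto (fun j => sobolevH10.val (z j)) atTop (𝓝 (sobolevH10.val z₀)) :=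
      (sobolevH10.val.continuous.tendsto z₀).comp hlim
    obtain ⟨ns, hns, hae⟩ := (tendstoInMeasure_of_tendsto_Lp hv).exists_seq_tendsto_ae
    set R : sobolevH10 Ω → ℝ≥0∞ := fun w =>
      ENNReal.ofReal (ε * ∑ i, ‖sobolevH10.grad i w‖ ^ 2 + M * ‖sobolevH10.val w‖ ^ 2) with hR
    have hRc : Continuous R := ENNReal.continuous_ofReal.comp (by fun_prop)
    have hRlim : Tendsto (fun j => R (z (ns j))) atTop (𝓝 (R z₀)) :=
      ((hRc.tendsto z₀).comp hlim).comp hns.tendsto_atTop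
    calc ∫⁻ x in Ω, ‖q x‖ₑ * ‖sobolevH10.val z₀ x‖ₑ ^ 2
        = ∫⁻ x in Ω, liminf (fun j => ‖q x‖ₑ * ‖sobolevH10.val (z (ns j)) x‖ₑ ^ 2) atTop := by
          refine lintegral_congr_ae ?_
          filter_upwards [hae] with x hx
          refine (Tendsto.liminf_eq ?_).symm
          refine ENNReal.Tendsto.const_mul ?_ (Or.inr enorm_ne_top)
          exact ((ENNReal.continuous_pow 2).tendsto _).comp hx.enorm
      _ ≤ liminf (fun j => ∫⁻ x in Ω, ‖q x‖ₑ * ‖sobolevH10.val (z (ns j)) x‖ₑ ^ 2) atTop := by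
          refine lintegral_liminf_le' fun j => ?_
          exact hq.1.enorm.mul ((Lp.aestronglyMeasurable _).enorm.pow_const 2)
      _ ≤ liminf (fun j => R (z (ns j))) atTop :=
          liminf_le_liminf (Eventually.of_forall fun j => hz (ns j))
      _ = R z₀ := hRlim.liminf_eq
  · simp only [sobolevH10.val_ofTest, sobolevH10.grad_ofTest]
    set A : Set (EuclideanSpace ℝ (Fin n)) := {x | M ≤ ‖q' x‖₊} with hA
    have hAm : MeasurableSet A := measurableSet_le measurable_const hq'm.nnnorm.coe_nnreal_real
    have hsplit : ∀ᵐ x ∂volume.restrict Ω, ‖q x‖ₑ * ‖hφ.toL2 x‖ₑ ^ 2 ≤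
        ((fun x => ‖A.indicator q' x‖ₑ) * fun x => ‖φ x‖ₑ ^ 2) x
          + ENNReal.ofReal M * ‖hφ.toL2 x‖ₑ ^ 2 := by
      filter_upwards [hqq, hφ.coeFn_toL2] with x h1 h2
      rw [h1, h2, Pi.mul_apply, ← add_mul]
      gcongr
      by_cases hx : x ∈ A
      · rw [Set.indicator_of_mem hx]
        exact le_self_add
      · have : ‖q' x‖ ≤ M := (not_le.1 hx).le
        rw [← ofReal_norm]
        exact (ENNReal.ofReal_le_ofReal this).trans le_add_self
    have hconj : ((n : ℝ) / 2).HolderConjugate ((n : ℝ) / (n - 2)) :=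
      ⟨by field_simp; ring, by positivity, by positivity⟩
    have hHolder := ENNReal.lintegral_mul_le_Lp_mul_Lq (volume.restrict Ω) hconj
      (f := fun x => ‖A.indicator q' x‖ₑ) (g := fun x => ‖φ x‖ₑ ^ 2)
      (hq'm.indicator hAm).enorm.aemeasurable (by have := hφ.continuous; fun_prop)
    have hpt : ((n : ℝ≥0∞) / 2).toReal = (n : ℝ) / 2 := by simp
    have hp0 : (n : ℝ≥0∞) / 2 ≠ 0 := by
      simp; lia
    have hptop : (n : ℝ≥0∞) / 2 ≠ ⊤ := ENNReal.div_ne_top (by simp) (by simp)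
    have hone : (∫⁻ x in Ω, ‖A.indicator q' x‖ₑ ^ ((n : ℝ) / 2)) ^ (1 / ((n : ℝ) / 2)) ≤
        ENNReal.ofReal (ε / (S + 1)) := by
      rw [eLpNorm_eq_lintegral_rpow_enorm_toReal hp0 hptop, hpt] at hM
      exact hM
    have htwo : (∫⁻ x in Ω, (‖φ x‖ₑ ^ 2) ^ ((n : ℝ) / (n - 2))) ^ (1 / ((n : ℝ) / (n - 2))) ≤
        S * ENNReal.ofReal (∑ i, ‖(hφ.partialDeriv i).toL2‖ ^ 2) := by
      refine le_trans ?_ (hS φ hφ)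
      exact ENNReal.rpow_le_rpow (setLIntegral_le_lintegral _ _) (by positivity)
    have hsum : 0 ≤ ∑ i, ‖(hφ.partialDeriv i).toL2‖ ^ 2 :=
      Finset.sum_nonneg fun i _ => by positivity
    calc ∫⁻ x in Ω, ‖q x‖ₑ * ‖hφ.toL2 x‖ₑ ^ 2
        ≤ ∫⁻ x in Ω, (((fun x => ‖A.indicator q' x‖ₑ) * fun x => ‖φ x‖ₑ ^ 2) x
          + ENNReal.ofReal M * ‖hφ.toL2 x‖ₑ ^ 2) := lintegral_mono_ae hsplit
      _ = (∫⁻ x in Ω, ((fun x => ‖A.indicator q' x‖ₑ) * fun x => ‖φ x‖ₑ ^ 2) x)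
          + ENNReal.ofReal M * ENNReal.ofReal (‖hφ.toL2‖ ^ 2) := by
          rw [lintegral_add_right' _
              (((Lp.aestronglyMeasurable _).enorm.pow_const 2).const_mul _),
            lintegral_const_mul'' _ ((Lp.aestronglyMeasurable _).enorm.pow_const 2),
            Lp_norm_sq_eq_lintegral]
      _ ≤ ENNReal.ofReal (ε / (S + 1)) *
            (S * ENNReal.ofReal (∑ i, ‖(hφ.partialDeriv i).toL2‖ ^ 2))
          + ENNReal.ofReal M * ENNReal.ofReal (‖hφ.toL2‖ ^ 2) := by
          gcongr
          exact hHolder.trans (mul_le_mul' hone htwo)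
      _ ≤ _ := by
          rw [ENNReal.ofReal_add (by positivity) (by positivity), ← ENNReal.ofReal_mul hM0.le,
            ← mul_assoc, ENNReal.ofReal_mul hε.le]
          gcongr
          rw [← ENNReal.ofReal_coe_nnreal, ← ENNReal.ofReal_mul (by positivity)]
          refine ENNReal.ofReal_le_ofReal ?_
          rw [div_mul_eq_mul_div, div_le_iff₀ (by positivity)]
          nlinarith

end FormBound

/-! ### The operator of the Schrödinger form on `H¹₀(Ω)` -/

section FormOperator

variable {n : ℕ} {Ω : Set (EuclideanSpace ℝ (Fin n))}

/-- A function whose square is form-bounded acts by multiplication from `H¹₀(Ω)` to `L²(Ω)`. -/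
theorem exists_multiplication_operator {m : EuclideanSpace ℝ (Fin n) → ℝ}
    (hm : AEStronglyMeasurable m (volume.restrict Ω)) {K : ℝ}
    (h : ∀ w : sobolevH10 Ω, ∫⁻ x in Ω, ‖(m x : ℂ) * sobolevH10.val w x‖ₑ ^ 2 ≤
      ENNReal.ofReal (K * ‖w‖ ^ 2)) :
    ∃ T : sobolevH10 Ω →L[ℂ] L2Space Ω,
      ∀ w, T w =ᵐ[volume.restrict Ω] fun x => (m x : ℂ) * sobolevH10.val w x := by
  have hmem : ∀ w : sobolevH10 Ω,
      MemLp (fun x => (m x : ℂ) * sobolevH10.val w x) 2 (volume.restrict Ω) := by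
    intro w
    refine ⟨(Complex.continuous_ofReal.comp_aestronglyMeasurable hm).mul
      (Lp.aestronglyMeasurable _), ?_⟩
    rw [eLpNorm_lt_top_iff_lintegral_rpow_enorm_lt_top (by norm_num) (by norm_num)]
    refine lt_of_le_of_lt (le_of_eq ?_) ((h w).trans_lt ENNReal.ofReal_lt_top)
    simp
  let L : sobolevH10 Ω →ₗ[ℂ] L2Space Ω :=
    { toFun := fun w => (hmem w).toLp _
      map_add' := fun w z => by
        rw [← MemLp.toLp_add, MemLp.toLp_eq_toLp_iff]
        have := Lp.coeFn_add (sobolevH10.val w) (sobolevH10.val z)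
        rw [← map_add] at this
        filter_upwards [this] with x hx
        rw [hx]
        simp [mul_add]
      map_smul' := fun c w => by
        rw [RingHom.id_apply, ← MemLp.toLp_const_smul, MemLp.toLp_eq_toLp_iff]
        have := Lp.coeFn_smul c (sobolevH10.val w)
        rw [← map_smul] at this
        filter_upwards [this] with x hx
        rw [hx]
        simp [mul_left_comm] }
  have hL : ∀ w, L w =ᵐ[volume.restrict Ω] fun x => (m x : ℂ) * sobolevH10.val w x :=
    fun w => (hmem w).coeFn_toLp
  refine ⟨L.mkContinuous √(max K 0) fun w => ?_, hL⟩
  refine abs_le_of_sq_le_sq' ?_ (by positivity) |>.2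
  rw [mul_pow, Real.sq_sqrt (le_max_right _ _)]
  have h1 : ENNReal.ofReal (‖L w‖ ^ 2) ≤ ENNReal.ofReal (K * ‖w‖ ^ 2) := by
    rw [Lp_norm_sq_eq_lintegral]
    refine le_trans (le_of_eq (lintegral_congr_ae ?_)) (h w)
    filter_upwards [hL w] with x hx
    rw [hx]
  rcases le_or_gt 0 (K * ‖w‖ ^ 2) with hK | hK
  · refine ((ENNReal.ofReal_le_ofReal_iff hK).1 h1).trans ?_
    gcongr
    exact le_max_left _ _
  · rw [ENNReal.ofReal_of_nonpos hK.le, nonpos_iff_eq_zero, ENNReal.ofReal_eq_zero] at h1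
    exact h1.trans (by positivity)

theorem sum_norm_grad_sq_nonneg (w : sobolevH10 Ω) : 0 ≤ ∑ i, ‖sobolevH10.grad i w‖ ^ 2 :=
  Finset.sum_nonneg fun _ _ => by positivity

/-- The potential energy factors through two multiplication operators `H¹₀(Ω) → L²(Ω)`. -/
theorem exists_potential_factorization (hn : 3 ≤ n) {q : EuclideanSpace ℝ (Fin n) → ℝ}
    (hq : MemLp q ((n : ℝ≥0∞) / 2) (volume.restrict Ω)) :
    ∃ T₁ T₂ : sobolevH10 Ω →L[ℂ] L2Space Ω,
      (∀ w z, (fun x => inner ℂ (T₁ z x) (T₂ w x)) =ᵐ[volume.restrict Ω]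
        fun x => (q x : ℂ) * sobolevH10.val w x * conj (sobolevH10.val z x)) ∧
      (∀ w z, (inner ℂ (T₁ z) (T₂ w) : ℂ) = inner ℂ (T₂ z) (T₁ w)) ∧
      (∀ w, ENNReal.ofReal (‖T₁ w‖ ^ 2) =
        ∫⁻ x in Ω, ‖q x‖ₑ * ‖sobolevH10.val w x‖ₑ ^ 2) ∧
      ∀ w, ENNReal.ofReal (‖T₂ w‖ ^ 2) =
        ∫⁻ x in Ω, ‖q x‖ₑ * ‖sobolevH10.val w x‖ₑ ^ 2 := by
  have hbound : ∀ m : EuclideanSpace ℝ (Fin n) → ℝ, (∀ x, m x ^ 2 = |q x|) →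
      ∀ w : sobolevH10 Ω, ∫⁻ x in Ω, ‖(m x : ℂ) * sobolevH10.val w x‖ₑ ^ 2 =
        ∫⁻ x in Ω, ‖q x‖ₑ * ‖sobolevH10.val w x‖ₑ ^ 2 := by
    intro m hm w
    refine lintegral_congr fun x => ?_
    rw [enorm_mul, mul_pow]
    congr 1
    rw [← ofReal_norm, ← ofReal_norm, ← ENNReal.ofReal_pow (norm_nonneg _), Complex.norm_real,
      Real.norm_eq_abs, sq_abs, hm, Real.norm_eq_abs]
  have hbd : ∃ K : ℝ, ∀ w : sobolevH10 Ω,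
      ∫⁻ x in Ω, ‖q x‖ₑ * ‖sobolevH10.val w x‖ₑ ^ 2 ≤ ENNReal.ofReal (K * ‖w‖ ^ 2) := by
    obtain ⟨C, hC, h⟩ := exists_lintegral_potential_le hn hq one_pos
    refine ⟨1 + C, fun w => (h w).trans (ENNReal.ofReal_le_ofReal ?_)⟩
    rw [sobolevH10.norm_sq_eq]
    nlinarith [sum_norm_grad_sq_nonneg w, sq_nonneg ‖sobolevH10.val w‖]
  obtain ⟨K, hK⟩ := hbd
  -- The multipliers are `|q|^{1/2}` and `sgn(q)|q|^{1/2}`: each has square `|q|`, and their product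
  -- is `q`.
  have hm₁ : ∀ x, √|q x| ^ 2 = |q x| := fun x => Real.sq_sqrt (abs_nonneg _)
  have hm₂ : ∀ x, (SignType.sign (q x) * √|q x|) ^ 2 = |q x| := by
    intro x
    rw [mul_pow, hm₁]
    rcases lt_trichotomy (q x) 0 with h | h | h
    · simp [sign_neg h]
    · simp [h]
    · simp [sign_pos h]
  have hmeas₁ : AEStronglyMeasurable (fun x => √|q x|) (volume.restrict Ω) :=
    (Real.continuous_sqrt.comp continuous_abs).comp_aestronglyMeasurable hq.1
  have hmeas₂ : AEStronglyMeasurable (fun x => (SignType.sign (q x) * √|q x| : ℝ))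
      (volume.restrict Ω) := by
    have hs : Measurable fun t : ℝ => ((SignType.sign t : ℝ)) := by
      have : (fun t : ℝ => ((SignType.sign t : ℝ))) =
          fun t => if 0 < t then 1 else if t < 0 then -1 else 0 := by
        ext t
        rcases lt_trichotomy t 0 with h | h | h
        · simp [sign_neg h, h, h.le.not_gt]
        · simp [h]
        · simp [sign_pos h, h]
      rw [this]
      exact Measurable.ite measurableSet_Ioi measurable_const
        (Measurable.ite measurableSet_Iio measurable_const measurable_const)
    exact ((hs.comp_aemeasurable hq.1.aemeasurable).aestronglyMeasurable).mul hmeas₁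
  obtain ⟨T₁, hT₁⟩ := exists_multiplication_operator hmeas₁ (K := K)
    fun w => (hbound _ hm₁ w).trans_le (hK w)
  obtain ⟨T₂, hT₂⟩ := exists_multiplication_operator hmeas₂ (K := K)
    fun w => (hbound _ hm₂ w).trans_le (hK w)
  have hmul : ∀ x, ((SignType.sign (q x) * √|q x| : ℝ) : ℂ) * ((√|q x| : ℝ) : ℂ) = q x := by
    intro x
    rw [← Complex.ofReal_mul, mul_assoc, Real.mul_self_sqrt (abs_nonneg _), sign_mul_abs]
  have hinner : ∀ w z : sobolevH10 Ω,
      (fun x => inner ℂ (T₁ z x) (T₂ w x)) =ᵐ[volume.restrict Ω]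
        fun x => (q x : ℂ) * sobolevH10.val w x * conj (sobolevH10.val z x) := by
    intro w z
    filter_upwards [hT₁ z, hT₂ w] with x h1 h2
    rw [h1, h2, RCLike.inner_apply, map_mul, Complex.conj_ofReal, ← hmul]
    ring
  have hsymm : ∀ w z : sobolevH10 Ω, (inner ℂ (T₁ z) (T₂ w) : ℂ) = inner ℂ (T₂ z) (T₁ w) := by
    intro w z
    rw [L2.inner_def, L2.inner_def]
    refine integral_congr_ae ?_
    filter_upwards [hT₁ z, hT₂ w, hT₂ z, hT₁ w] with x h1 h2 h3 h4
    simp only [h1, h2, h3, h4, RCLike.inner_apply, map_mul, Complex.conj_ofReal]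
    ring
  have hT₁norm : ∀ w, ENNReal.ofReal (‖T₁ w‖ ^ 2) =
      ∫⁻ x in Ω, ‖q x‖ₑ * ‖sobolevH10.val w x‖ₑ ^ 2 := by
    intro w
    rw [Lp_norm_sq_eq_lintegral, ← hbound _ hm₁ w]
    refine lintegral_congr_ae ?_
    filter_upwards [hT₁ w] with x hx
    rw [hx]
  have hT₂norm : ∀ w, ENNReal.ofReal (‖T₂ w‖ ^ 2) =
      ∫⁻ x in Ω, ‖q x‖ₑ * ‖sobolevH10.val w x‖ₑ ^ 2 := by
    intro w
    rw [Lp_norm_sq_eq_lintegral, ← hbound _ hm₂ w]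
    refine lintegral_congr_ae ?_
    filter_upwards [hT₂ w] with x hx
    rw [hx]
  exact ⟨T₁, T₂, hinner, hsymm, hT₁norm, hT₂norm⟩

/-- The Schrödinger form is `⟪z, A w⟫` for a symmetric operator `A` on `H¹₀(Ω)` that is bounded
below by a multiple of the Laplacian up to a constant. -/
theorem exists_form_operator (hn : 3 ≤ n) {q : EuclideanSpace ℝ (Fin n) → ℝ}
    (hq : MemLp q ((n : ℝ≥0∞) / 2) (volume.restrict Ω)) :
    ∃ A : sobolevH10 Ω →L[ℂ] sobolevH10 Ω,
      (∀ w z, inner ℂ (A w) z = inner ℂ w (A z)) ∧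
      (∀ w z, schrodingerForm Ω q (sobolevH10.val w) (fun i => sobolevH10.grad i w)
        (sobolevH10.val z) (fun i => sobolevH10.grad i z) = inner ℂ z (A w)) ∧
      ∀ ε : ℝ, 0 < ε → ∃ C : ℝ, 0 < C ∧ ∀ w : sobolevH10 Ω,
        (1 - ε) * ∑ i, ‖sobolevH10.grad i w‖ ^ 2 - C * ‖sobolevH10.val w‖ ^ 2 ≤
          (inner ℂ w (A w) : ℂ).re := by
  obtain ⟨T₁, T₂, hinner, hsymm, hT₁norm, hT₂norm⟩ := exists_potential_factorization hn hq
  obtain ⟨A, hA⟩ : ∃ A : sobolevH10 Ω →L[ℂ] sobolevH10 Ω, ∀ w z : sobolevH10 Ω,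
      inner ℂ z (A w) = ∑ i, inner ℂ (sobolevH10.grad i z) (sobolevH10.grad i w)
        + inner ℂ (T₁ z) (T₂ w) := by
    -- `A = ∑ ∂ᵢ* ∂ᵢ + T₁* T₂`, with adjoints taken for the graph inner product of `H¹₀(Ω)`.
    refine ⟨∑ i, (ContinuousLinearMap.adjoint (sobolevH10.grad i)).comp (sobolevH10.grad i)
      + (ContinuousLinearMap.adjoint T₁).comp T₂, fun w z => ?_⟩
    simp [ContinuousLinearMap.adjoint_inner_right]
  refine ⟨A, fun w z => ?_, fun w z => ?_, fun ε hε => ?_⟩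
  · rw [← inner_conj_symm, hA, hA, map_add, map_sum, inner_conj_symm, ← hsymm]
    simp only [inner_conj_symm]
  · rw [hA, schrodingerForm, integral_add, L2.inner_def, integral_congr_ae (hinner w z)]
    · congr 1
      rw [integral_finsetSum]
      · refine Finset.sum_congr rfl fun i _ => ?_
        rw [L2.inner_def]
        simp
      · intro i _
        have := L2.integrable_inner (𝕜 := ℂ) (sobolevH10.grad i z) (sobolevH10.grad i w)
        simpa using this
    · refine integrable_finsetSum _ fun i _ => ?_
      have := L2.integrable_inner (𝕜 := ℂ) (sobolevH10.grad i z) (sobolevH10.grad i w)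
      simpa using this
    · exact (L2.integrable_inner (𝕜 := ℂ) (T₁ z) (T₂ w)).congr (hinner w z)
  · obtain ⟨C, hC, h⟩ := exists_lintegral_potential_le hn hq hε
    refine ⟨C, hC, fun w => ?_⟩
    rw [hA, Complex.add_re, Complex.re_sum]
    have h1 : ∀ i, (inner ℂ (sobolevH10.grad i w) (sobolevH10.grad i w) : ℂ).re
        = ‖sobolevH10.grad i w‖ ^ 2 := fun i => by
      rw [inner_self_eq_norm_sq_to_K]; norm_cast
    simp only [h1]
    have hpos : 0 ≤ ε * ∑ i, ‖sobolevH10.grad i w‖ ^ 2 + C * ‖sobolevH10.val w‖ ^ 2 := by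
      have := sum_norm_grad_sq_nonneg w
      positivity
    -- The potential term is at most `‖T₁w‖‖T₂w‖ ≤ (‖T₁w‖² + ‖T₂w‖²)/2` in absolute value, and both
    -- squares equal `∫ |q||u|²`.
    have e1 := (ENNReal.ofReal_le_ofReal_iff hpos).1 ((hT₁norm w).trans_le (h w))
    have e2 := (ENNReal.ofReal_le_ofReal_iff hpos).1 ((hT₂norm w).trans_le (h w))
    have e3 := Complex.abs_re_le_norm (inner ℂ (T₁ w) (T₂ w))
    have e4 := norm_inner_le_norm (𝕜 := ℂ) (T₁ w) (T₂ w)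
    have e5 := neg_abs_le (inner ℂ (T₁ w) (T₂ w) : ℂ).re
    nlinarith [sq_nonneg (‖T₁ w‖ - ‖T₂ w‖)]

/-- Dirichlet eigenfunctions in terms of the form operator. -/
theorem isDirichletEigenvector_iff {q : EuclideanSpace ℝ (Fin n) → ℝ}
    {A : sobolevH10 Ω →L[ℂ] sobolevH10 Ω}
    (hA : ∀ w z, schrodingerForm Ω q (sobolevH10.val w) (fun i => sobolevH10.grad i w)
        (sobolevH10.val z) (fun i => sobolevH10.grad i z) = inner ℂ z (A w))
    {μ : ℝ} {u : L2Space Ω} :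
    IsDirichletEigenvector Ω q μ u ↔
      ∃ w : sobolevH10 Ω, sobolevH10.val w = u ∧
        ∀ z : sobolevH10 Ω, inner ℂ z (A w) = (μ : ℂ) * inner ℂ (sobolevH10.val z) u := by
  have hint : ∀ v : L2Space Ω, ∫ x in Ω, u x * conj (v x) = inner ℂ v u := by
    intro v
    rw [L2.inner_def]
    simp
  constructor
  · rintro ⟨G, hG, h⟩
    refine ⟨sobolevH10.ofGradient hG, rfl, fun z => ?_⟩
    rw [← hA, ← hint]
    exact h _ _ (sobolevH10.isH10WithGradient z)
  · rintro ⟨w, rfl, h⟩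
    refine ⟨fun i => sobolevH10.grad i w, sobolevH10.isH10WithGradient w, fun v H hv => ?_⟩
    have := h (sobolevH10.ofGradient hv)
    rw [← hA] at this
    rw [hint]
    exact this

end FormOperator

/-! ### Upper bound for the Riesz means -/

section UpperBound

variable {n : ℕ} {Ω : Set (EuclideanSpace ℝ (Fin n))}

/-- In polar coordinates with `r = √M/2π` this is `n V_B ∫₀^r (M - 4π²y²) y^(n-1) dy`; as `4π²r² =
M`, it equals `n V_B M rⁿ (1/n - 1/(n+2))`. -/
theorem integral_weylSymbol (hn : 0 < n) {M : ℝ} (hM : 0 ≤ M) :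
    ∫ ξ : EuclideanSpace ℝ (Fin n), weylSymbol M ξ =
      volume.real (Metric.ball (0 : EuclideanSpace ℝ (Fin n)) 1) * (2 / (n + 2)) * M *
        (√M / (2 * Real.pi)) ^ n := by
  have : Nonempty (Fin n) := ⟨⟨0, hn⟩⟩
  have hn' : (0 : ℝ) < n := by exact_mod_cast hn
  set r := √M / (2 * Real.pi) with hr
  have hr0 : 0 ≤ r := by positivity
  have hr2 : 4 * Real.pi ^ 2 * r ^ 2 = M := by
    rw [hr, div_pow, Real.sq_sqrt hM]
    have := Real.pi_pos.ne'
    field_simp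
    ring
  have h1 := integral_fun_norm_addHaar (volume : Measure (EuclideanSpace ℝ (Fin n)))
    (fun t : ℝ => max (M - 4 * Real.pi ^ 2 * t ^ 2) 0)
  have h2 : ∫ y in Set.Ioi (0 : ℝ), y ^ (n - 1) • max (M - 4 * Real.pi ^ 2 * y ^ 2) 0
      = ∫ y in (0 : ℝ)..r, (M * y ^ (n - 1) - 4 * Real.pi ^ 2 * y ^ (n + 1)) := by
    rw [intervalIntegral.integral_of_le hr0,
      setIntegral_eq_of_subset_of_forall_sdiff_eq_zero (s := Set.Ioc 0 r) measurableSet_Ioi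
        Set.Ioc_subset_Ioi_self]
    · refine setIntegral_congr_fun measurableSet_Ioc fun y hy => ?_
      have hy2 : y ^ 2 ≤ r ^ 2 := pow_le_pow_left₀ hy.1.le hy.2 2
      have hpos : 0 ≤ M - 4 * Real.pi ^ 2 * y ^ 2 := by
        rw [← hr2]
        have := mul_le_mul_of_nonneg_left hy2 (by positivity : 0 ≤ 4 * Real.pi ^ 2)
        linarith
      obtain ⟨m, rfl⟩ : ∃ m, n = m + 1 := ⟨n - 1, by lia⟩
      simp only [smul_eq_mul, max_eq_left hpos, Nat.add_sub_cancel]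
      ring
    · intro y hy
      have hry : r ≤ y := le_of_lt (not_le.1 fun h => hy.2 ⟨hy.1, h⟩)
      have hy2 : r ^ 2 ≤ y ^ 2 := pow_le_pow_left₀ hr0 hry 2
      have hneg : M - 4 * Real.pi ^ 2 * y ^ 2 ≤ 0 := by
        rw [← hr2]
        have := mul_le_mul_of_nonneg_left hy2 (by positivity : 0 ≤ 4 * Real.pi ^ 2)
        linarith
      rw [max_eq_right hneg, smul_zero]
  have h3 : ∫ y in (0 : ℝ)..r, (M * y ^ (n - 1) - 4 * Real.pi ^ 2 * y ^ (n + 1))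
      = M * (r ^ n / n) - M * (r ^ n / (n + 2)) := by
    rw [intervalIntegral.integral_sub (Continuous.intervalIntegrable (by fun_prop) _ _)
        (Continuous.intervalIntegrable (by fun_prop) _ _),
      intervalIntegral.integral_const_mul, intervalIntegral.integral_const_mul,
      integral_pow, integral_pow]
    obtain ⟨m, rfl⟩ : ∃ m, n = m + 1 := ⟨n - 1, by lia⟩
    simp only [Nat.add_sub_cancel]
    rw [zero_pow (by lia), zero_pow (by lia)]
    conv_rhs => rw [← hr2]
    conv_lhs => rw [← hr2]
    push_cast
    field_simp
    ring
  rw [finrank_euclideanSpace, Fintype.card_fin, h2, h3] at h1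
  refine h1.trans ?_
  simp only [nsmul_eq_mul, smul_eq_mul]
  field_simp
  ring

/-- **Berezin–Li–Yau inequality** for an orthonormal family in `H¹₀(Ω)`. -/
theorem sum_sub_norm_grad_sq_le (hb : Bornology.IsBounded Ω) {ι : Type*} {w : ι → sobolevH10 Ω}
    (hw : Orthonormal ℂ fun i => sobolevH10.val (w i)) (s : Finset ι) (M : ℝ) :
    ∑ j ∈ s, (M - ∑ i, ‖sobolevH10.grad i (w j)‖ ^ 2) ≤
      volume.real Ω * ∫ ξ : EuclideanSpace ℝ (Fin n), weylSymbol M ξ := by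
  have hint : ∀ u : L2Space Ω, Integrable fun ξ : EuclideanSpace ℝ (Fin n) =>
      weylSymbol M ξ * ‖(inner ℂ (planeWave hb ξ) u : ℂ)‖ ^ 2 := by
    intro u
    refine (integrable_weylSymbol M).mul_bdd (c := volume.real Ω * ‖u‖ ^ 2)
      (((continuous_planeWave hb).inner continuous_const).norm.pow 2).aestronglyMeasurable
      (Eventually.of_forall fun ξ => ?_)
    rw [norm_pow, norm_norm, ← norm_planeWave_sq hb ξ, ← mul_pow]
    gcongr
    exact norm_inner_le_norm _ _
  calc ∑ j ∈ s, (M - ∑ i, ‖sobolevH10.grad i (w j)‖ ^ 2)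
      ≤ ∑ j ∈ s, ∫ ξ, weylSymbol M ξ *
          ‖(inner ℂ (planeWave hb ξ) (sobolevH10.val (w j)) : ℂ)‖ ^ 2 := by
        refine Finset.sum_le_sum fun j _ => ?_
        have := mul_norm_sq_sub_grad_le hb M (w j)
        rwa [hw.1 j, one_pow, mul_one] at this
    _ = ∫ ξ, ∑ j ∈ s, weylSymbol M ξ *
          ‖(inner ℂ (planeWave hb ξ) (sobolevH10.val (w j)) : ℂ)‖ ^ 2 :=
        (integral_finsetSum _ fun j _ => hint _).symm
    _ ≤ ∫ ξ : EuclideanSpace ℝ (Fin n), volume.real Ω * weylSymbol M ξ := by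
        refine integral_mono (integrable_finsetSum _ fun j _ => hint _)
          ((integrable_weylSymbol M).const_mul _) fun ξ => ?_
        simp only
        rw [← Finset.mul_sum, mul_comm]
        refine mul_le_mul_of_nonneg_right ?_ (weylSymbol_nonneg _ _)
        -- Bessel in the index `j` at fixed `ξ`: the orthonormal family is tested against a single
        -- plane wave.
        rw [← norm_planeWave_sq hb ξ]
        refine le_trans (le_of_eq (Finset.sum_congr rfl fun j _ => ?_))
          (hw.sum_inner_products_le (planeWave hb ξ) (s := s))
        rw [norm_inner_symm]
    _ = _ := integral_const_mul _ _

/-- Upper bound for the Riesz means of the eigenvalues of a form bounded below by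
`(1 - ε)(-Δ) - C`. -/
theorem sum_sub_eigenvalue_le (hb : Bornology.IsBounded Ω)
    {A : sobolevH10 Ω →L[ℂ] sobolevH10 Ω} {ε C : ℝ} (hε : ε < 1)
    (hA : ∀ w : sobolevH10 Ω,
        (1 - ε) * ∑ i, ‖sobolevH10.grad i w‖ ^ 2 - C * ‖sobolevH10.val w‖ ^ 2 ≤
          (inner ℂ w (A w) : ℂ).re)
    {ι : Type*} {w : ι → sobolevH10 Ω} (hw : Orthonormal ℂ fun i => sobolevH10.val (w i))
    {lam : ι → ℝ} (hlam : ∀ j, (inner ℂ (w j) (A (w j)) : ℂ).re = lam j)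
    (s : Finset ι) (t : ℝ) :
    ∑ j ∈ s, (t - lam j) ≤ (1 - ε) * (volume.real Ω *
      ∫ ξ : EuclideanSpace ℝ (Fin n), weylSymbol ((t + C) / (1 - ε)) ξ) := by
  have hε' : 0 < 1 - ε := by linarith
  -- The lower bound on the form reads `t - λⱼ ≤ (1 - ε)(M - ‖∇uⱼ‖²)` with `M = (t + C)/(1 - ε)`.
  refine le_trans ?_ (mul_le_mul_of_nonneg_left
    (sum_sub_norm_grad_sq_le hb hw s ((t + C) / (1 - ε))) hε'.le)
  rw [Finset.mul_sum]
  refine Finset.sum_le_sum fun j _ => ?_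
  have h := hA (w j)
  rw [hlam, hw.1 j] at h
  rw [mul_sub, mul_div_cancel₀ _ hε'.ne']
  linarith

end UpperBound

/-! ### Lower bound for the Riesz means -/

section LowerBound

open scoped FourierTransform RealInnerProductSpace

variable {n : ℕ} {Ω : Set (EuclideanSpace ℝ (Fin n))}

theorem inner_self_eq_ofReal_norm_sq {E : Type*} [NormedAddCommGroup E] [InnerProductSpace ℂ E]
    (x : E) : inner ℂ x x = ((‖x‖ ^ 2 : ℝ) : ℂ) := by
  simp [inner_self_eq_norm_sq_to_K]

/-- Bessel's inequality for the energy form in an eigenbasis. -/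
theorem sum_eigenvalue_mul_norm_sq_le {A : sobolevH10 Ω →L[ℂ] sobolevH10 Ω}
    (hsymm : ∀ w z, inner ℂ (A w) z = inner ℂ w (A z)) {C : ℝ}
    (hC : ∀ w : sobolevH10 Ω, -(C * ‖sobolevH10.val w‖ ^ 2) ≤ (inner ℂ w (A w) : ℂ).re)
    {w : ℕ → sobolevH10 Ω} (hw : Orthonormal ℂ fun j => sobolevH10.val (w j)) {lam : ℕ → ℝ}
    (hlam : ∀ j z, inner ℂ z (A (w j)) =
      (lam j : ℂ) * inner ℂ (sobolevH10.val z) (sobolevH10.val (w j)))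
    (v : sobolevH10 Ω) (N : ℕ) :
    ∑ j ∈ Finset.range N,
        lam j * ‖(inner ℂ (sobolevH10.val (w j)) (sobolevH10.val v) : ℂ)‖ ^ 2 ≤
      (inner ℂ v (A v) : ℂ).re + C * (‖sobolevH10.val v‖ ^ 2 - ∑ j ∈ Finset.range N,
        ‖(inner ℂ (sobolevH10.val (w j)) (sobolevH10.val v) : ℂ)‖ ^ 2) := by
  set c : ℕ → ℂ := fun j => inner ℂ (sobolevH10.val (w j)) (sobolevH10.val v) with hc
  -- `s` is the `L²`-projection of `v` onto the first `N` eigenvectors. By the eigenvalue equation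
  -- `⟪v, A s⟫`, `⟪s, A v⟫` and `⟪s, A s⟫` coincide, so the energy of `v - s` is that of `v` minus
  -- the partial sum; semiboundedness at `v - s` is the claim.
  set s : sobolevH10 Ω := ∑ j ∈ Finset.range N, c j • w j with hs
  have hvals : sobolevH10.val s = ∑ j ∈ Finset.range N, c j • sobolevH10.val (w j) := by
    simp [hs, map_sum]
  have hcs : ∀ j ∈ Finset.range N,
      inner ℂ (sobolevH10.val (w j)) (sobolevH10.val s) = c j := by
    intro j hj
    rw [hvals, hw.inner_right_sum c hj]
  have hsq : ∀ z : ℂ, z * conj z = ((‖z‖ ^ 2 : ℝ) : ℂ) := fun z => by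
    rw [Complex.mul_conj, Complex.normSq_eq_norm_sq]
  have hAs : ∀ z : sobolevH10 Ω, (∀ j ∈ Finset.range N,
      inner ℂ (sobolevH10.val (w j)) (sobolevH10.val z) = c j) →
      inner ℂ z (A s) = ((∑ j ∈ Finset.range N, lam j * ‖c j‖ ^ 2 : ℝ) : ℂ) := by
    intro z hz
    rw [hs, map_sum, inner_sum, Complex.ofReal_sum]
    refine Finset.sum_congr rfl fun j hj => ?_
    rw [map_smul, inner_smul_right, hlam, ← inner_conj_symm (sobolevH10.val z), hz j hj,
      Complex.ofReal_mul, ← hsq]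
    ring
  have hss : ∀ z : L2Space Ω, (∀ j ∈ Finset.range N,
      inner ℂ (sobolevH10.val (w j)) z = c j) →
      inner ℂ z (sobolevH10.val s) = ((∑ j ∈ Finset.range N, ‖c j‖ ^ 2 : ℝ) : ℂ) := by
    intro z hz
    rw [hvals, inner_sum, Complex.ofReal_sum]
    refine Finset.sum_congr rfl fun j hj => ?_
    rw [inner_smul_right, ← inner_conj_symm z, hz j hj, ← hsq]
  have h1 := hAs v fun j _ => rfl
  have h2 := hAs s hcs
  have h3 : inner ℂ s (A v) = ((∑ j ∈ Finset.range N, lam j * ‖c j‖ ^ 2 : ℝ) : ℂ) := by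
    rw [← hsymm, ← inner_conj_symm, h1, Complex.conj_ofReal]
  have h4 : inner ℂ (v - s) (A (v - s)) =
      inner ℂ v (A v) - ((∑ j ∈ Finset.range N, lam j * ‖c j‖ ^ 2 : ℝ) : ℂ) := by
    rw [map_sub, inner_sub_left, inner_sub_right, inner_sub_right, h1, h2, h3]
    ring
  have h5 : ‖sobolevH10.val (v - s)‖ ^ 2 =
      ‖sobolevH10.val v‖ ^ 2 - ∑ j ∈ Finset.range N, ‖c j‖ ^ 2 := by
    have e1 := hss (sobolevH10.val v) fun j _ => rfl
    have e2 := hss (sobolevH10.val s) hcs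
    have e3 : ‖sobolevH10.val s‖ ^ 2 = ∑ j ∈ Finset.range N, ‖c j‖ ^ 2 := by
      rw [inner_self_eq_ofReal_norm_sq] at e2
      exact_mod_cast e2
    rw [map_sub, norm_sub_sq (𝕜 := ℂ), e1, e3]
    simp only [RCLike.re_eq_complex_re, Complex.ofReal_re]
    ring
  have h6 := hC (v - s)
  rw [h4, h5, Complex.sub_re, Complex.ofReal_re] at h6
  linarith

/-- Lower bound for the Riesz mean of the spectral measure of `v`. -/
theorem mul_norm_sq_sub_form_le {A : sobolevH10 Ω →L[ℂ] sobolevH10 Ω}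
    (hsymm : ∀ w z, inner ℂ (A w) z = inner ℂ w (A z)) {C : ℝ}
    (hC : ∀ w : sobolevH10 Ω, -(C * ‖sobolevH10.val w‖ ^ 2) ≤ (inner ℂ w (A w) : ℂ).re)
    (b : HilbertBasis ℕ ℂ (L2Space Ω))
    {w : ℕ → sobolevH10 Ω} (hw : ∀ j, sobolevH10.val (w j) = b j) {lam : ℕ → ℝ}
    (hlam : ∀ j z, inner ℂ z (A (w j)) = (lam j : ℂ) * inner ℂ (sobolevH10.val z) (b j))
    {t : ℝ} {N₀ : ℕ} (hN₀ : ∀ j, N₀ ≤ j → t ≤ lam j) (v : sobolevH10 Ω) :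
    t * ‖sobolevH10.val v‖ ^ 2 - (inner ℂ v (A v) : ℂ).re ≤
      ∑ j ∈ Finset.range N₀, max (t - lam j) 0 *
        ‖(inner ℂ (b j) (sobolevH10.val v) : ℂ)‖ ^ 2 := by
  have hsum : HasSum (fun j => ‖(inner ℂ (b j) (sobolevH10.val v) : ℂ)‖ ^ 2)
      (‖sobolevH10.val v‖ ^ 2) := by
    have h := b.hasSum_inner_mul_inner (sobolevH10.val v) (sobolevH10.val v)
    rw [inner_self_eq_ofReal_norm_sq] at h
    have e : (fun j => inner ℂ (sobolevH10.val v) (b j) * inner ℂ (b j) (sobolevH10.val v)) =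
        fun j => ((‖(inner ℂ (b j) (sobolevH10.val v) : ℂ)‖ ^ 2 : ℝ) : ℂ) := by
      funext j
      rw [← inner_conj_symm (sobolevH10.val v), mul_comm, Complex.mul_conj,
        Complex.normSq_eq_norm_sq]
    rw [e] at h
    exact_mod_cast h
  have hlim := hsum.tendsto_sum_nat
  set X := ‖sobolevH10.val v‖ ^ 2
  set S : ℕ → ℝ := fun N =>
    ∑ j ∈ Finset.range N, ‖(inner ℂ (b j) (sobolevH10.val v) : ℂ)‖ ^ 2 with hS
  -- By Parseval `X - S N → 0`, so the price `C (X - S N)` of mere semiboundedness disappears in the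
  -- limit.
  have hlim2 : Tendsto (fun N => t * S N - (inner ℂ v (A v) : ℂ).re - C * (X - S N)) atTop
      (𝓝 (t * X - (inner ℂ v (A v) : ℂ).re - C * (X - X))) :=
    ((hlim.const_mul t).sub_const _).sub ((hlim.const_sub X).const_mul C)
  rw [sub_self, mul_zero, sub_zero] at hlim2
  refine le_of_tendsto hlim2 ?_
  filter_upwards [eventually_ge_atTop N₀] with N hN
  have hbessel := sum_eigenvalue_mul_norm_sq_le hsymm hC (w := w) (lam := lam)
    (by simpa only [hw] using b.orthonormal) (by simpa only [hw] using hlam) v N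
  simp only [hw] at hbessel
  have hle : t * S N - ∑ j ∈ Finset.range N,
      lam j * ‖(inner ℂ (b j) (sobolevH10.val v) : ℂ)‖ ^ 2 ≤
      ∑ j ∈ Finset.range N₀, max (t - lam j) 0 *
        ‖(inner ℂ (b j) (sobolevH10.val v) : ℂ)‖ ^ 2 := by
    rw [hS, Finset.mul_sum, ← Finset.sum_sub_distrib]
    have hsub : Finset.range N₀ ⊆ Finset.range N := Finset.range_subset_range.2 hN
    rw [Finset.sum_subset (f := fun j => max (t - lam j) 0 *
        ‖(inner ℂ (b j) (sobolevH10.val v) : ℂ)‖ ^ 2) hsub fun j _ hj => by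
      rw [max_eq_right (by linarith [hN₀ j (by simpa using hj)]), zero_mul]]
    refine Finset.sum_le_sum fun j _ => ?_
    rw [← sub_mul]
    gcongr
    exact le_max_left _ _
  linarith

/-! ### Cut-off plane waves as trial functions -/

variable {χ : EuclideanSpace ℝ (Fin n) → ℝ}

theorem contDiff_fourierChar_inner (ξ : EuclideanSpace ℝ (Fin n)) :
    ContDiff ℝ ∞ fun x : EuclideanSpace ℝ (Fin n) => (𝐞 ⟪x, ξ⟫ : ℂ) := by
  simp only [Real.fourierChar_apply]
  have h : ContDiff ℝ ∞ fun x : EuclideanSpace ℝ (Fin n) => 2 * Real.pi * ⟪x, ξ⟫ :=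
    contDiff_const.mul (contDiff_id.inner ℝ contDiff_const)
  exact ((Complex.ofRealCLM.contDiff.comp h).mul contDiff_const).cexp

/-- A cut-off times a plane wave is a test function. -/
theorem IsTestFunction.fourierChar_mul (hχ : IsTestFunction Ω fun x => (χ x : ℂ))
    (ξ : EuclideanSpace ℝ (Fin n)) :
    IsTestFunction Ω ((fun x => (𝐞 ⟪x, ξ⟫ : ℂ)) * fun x => (χ x : ℂ)) :=
  hχ.mul_left (contDiff_fourierChar_inner ξ)

/-- The derivative is `e_ξ (∂ᵢχ + 2πi ξᵢ χ)`. Since `χ` is real, the two terms are the real and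
imaginary parts and there is no cross term linear in `ξ`. -/
theorem norm_sq_partialDeriv_fourierChar_mul (hχ : Differentiable ℝ χ)
    (ξ x : EuclideanSpace ℝ (Fin n)) (i : Fin n) :
    ‖partialDeriv i ((fun x => (𝐞 ⟪x, ξ⟫ : ℂ)) * fun x => (χ x : ℂ)) x‖ ^ 2 =
      fderiv ℝ χ x (EuclideanSpace.single i 1) ^ 2 + 4 * Real.pi ^ 2 * ξ i ^ 2 * χ x ^ 2 := by
  have h1 : HasFDerivAt (fun y => (χ y : ℂ)) (Complex.ofRealCLM.comp (fderiv ℝ χ x)) x :=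
    Complex.ofRealCLM.hasFDerivAt.comp x (hχ x).hasFDerivAt
  have h2 : HasFDerivAt (fun y : EuclideanSpace ℝ (Fin n) => (𝐞 ⟪y, ξ⟫ : ℂ))
      ((𝐞 ⟪x, ξ⟫ : ℂ) • (2 * Real.pi * Complex.I : ℂ) •
        (Complex.ofRealCLM.comp (innerSL ℝ ξ))) x := by
    have h3 : ∀ y : EuclideanSpace ℝ (Fin n), (𝐞 ⟪y, ξ⟫ : ℂ) =
        Complex.exp ((2 * Real.pi * Complex.I : ℂ) • ((⟪ξ, y⟫ : ℝ) : ℂ)) := by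
      intro y
      rw [Real.fourierChar_apply, real_inner_comm, smul_eq_mul]
      push_cast
      ring_nf
    simp only [h3]
    have h4 := (Complex.ofRealCLM.hasFDerivAt.comp x (innerSL ℝ ξ).hasFDerivAt).const_smul
      (2 * Real.pi * Complex.I : ℂ)
    exact h4.cexp
  have h5 : partialDeriv i ((fun x => (𝐞 ⟪x, ξ⟫ : ℂ)) * fun x => (χ x : ℂ)) x =
      (𝐞 ⟪x, ξ⟫ : ℂ) * ((fderiv ℝ χ x (EuclideanSpace.single i 1) : ℝ) +
        (2 * Real.pi * ξ i * χ x : ℝ) * Complex.I) := by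
    rw [partialDeriv, (h2.mul h1).fderiv]
    simp [EuclideanSpace.inner_single_right]
    ring
  rw [h5, norm_mul, Circle.norm_coe, one_mul, Complex.sq_norm, Complex.normSq_add_mul_I]
  ring

end LowerBound

section LowerBoundRiesz

open scoped FourierTransform RealInnerProductSpace

variable {n : ℕ} {Ω : Set (EuclideanSpace ℝ (Fin n))} {χ : EuclideanSpace ℝ (Fin n) → ℝ}

theorem IsTestFunction.contDiff_of_ofReal (hχ : IsTestFunction Ω fun x => (χ x : ℂ)) :
    ContDiff ℝ ∞ χ :=
  Complex.reCLM.contDiff.comp hχ.contDiff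

theorem IsTestFunction.hasCompactSupport_of_ofReal (hχ : IsTestFunction Ω fun x => (χ x : ℂ)) :
    HasCompactSupport χ :=
  hχ.hasCompactSupport.comp_left (g := Complex.re) rfl

theorem IsTestFunction.norm_sq_toL2_fourierChar_mul
    (hχ : IsTestFunction Ω fun x => (χ x : ℂ)) (ξ : EuclideanSpace ℝ (Fin n)) :
    ‖(hχ.fourierChar_mul ξ).toL2‖ ^ 2 = ∫ x in Ω, χ x ^ 2 := by
  rw [L2_norm_sq_eq_integral]
  refine integral_congr_ae ?_
  filter_upwards [(hχ.fourierChar_mul ξ).coeFn_toL2] with x hx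
  rw [hx, Pi.mul_apply, norm_mul, Circle.norm_coe, one_mul, Complex.norm_real, Real.norm_eq_abs,
    sq_abs]

/-- The energy of a cut-off plane wave. -/
theorem schrodingerForm_fourierChar_mul {q : EuclideanSpace ℝ (Fin n) → ℝ}
    (hq : Integrable q (volume.restrict Ω))
    (hχ : IsTestFunction Ω fun x => (χ x : ℂ)) (ξ : EuclideanSpace ℝ (Fin n)) :
    schrodingerForm Ω q (hχ.fourierChar_mul ξ).toL2
        (fun i => ((hχ.fourierChar_mul ξ).partialDeriv i).toL2) (hχ.fourierChar_mul ξ).toL2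
        (fun i => ((hχ.fourierChar_mul ξ).partialDeriv i).toL2) =
      (((∫ x in Ω, ((∑ i, fderiv ℝ χ x (EuclideanSpace.single i 1) ^ 2) + q x * χ x ^ 2))
        + 4 * Real.pi ^ 2 * ‖ξ‖ ^ 2 * ∫ x in Ω, χ x ^ 2 : ℝ) : ℂ) := by
  have hcd := hχ.contDiff_of_ofReal
  have hcs := hχ.hasCompactSupport_of_ofReal
  have hi1 : ∀ i : Fin n, Integrable
      (fun x => fderiv ℝ χ x (EuclideanSpace.single i 1) ^ 2) (volume.restrict Ω) := by
    intro i
    have hc : Continuous fun x => fderiv ℝ χ x (EuclideanSpace.single i 1) :=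
      ((hcd.continuous_fderiv (by simp)).clm_apply continuous_const)
    have hc2 : Continuous fun x => fderiv ℝ χ x (EuclideanSpace.single i 1) ^ 2 := by fun_prop
    have hs : HasCompactSupport fun x => fderiv ℝ χ x (EuclideanSpace.single i 1) :=
      hcs.fderiv_apply ℝ _
    have hs2 : HasCompactSupport fun x => fderiv ℝ χ x (EuclideanSpace.single i 1) ^ 2 :=
      hs.comp_left (g := fun t : ℝ => t ^ 2) (by simp)
    exact hc2.integrable_of_hasCompactSupport hs2
  have hχc : Continuous fun x => χ x ^ 2 := by
    have := hcd.continuous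
    fun_prop
  have hχs : HasCompactSupport fun x => χ x ^ 2 :=
    hcs.comp_left (g := fun t : ℝ => t ^ 2) (by simp)
  have hi2 : Integrable (fun x => q x * χ x ^ 2) (volume.restrict Ω) := by
    obtain ⟨c, hc⟩ := hcs.exists_bound_of_continuous hcd.continuous
    refine hq.mul_bdd (c := c ^ 2) hχc.aestronglyMeasurable
      (Eventually.of_forall fun x => ?_)
    rw [norm_pow]
    gcongr
    exact hc x
  have hi3 : Integrable (fun x => χ x ^ 2) (volume.restrict Ω) :=
    hχc.integrable_of_hasCompactSupport hχs
  have hi4 : Integrable (fun x => (∑ i, fderiv ℝ χ x (EuclideanSpace.single i 1) ^ 2)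
      + q x * χ x ^ 2) (volume.restrict Ω) := (integrable_finsetSum _ fun i _ => hi1 i).add hi2
  rw [← integral_const_mul, ← integral_add hi4 (hi3.const_mul _), ← integral_complex_ofReal, schrodingerForm]
  refine integral_congr_ae ?_
  have hgrad : ∀ᵐ x ∂volume.restrict Ω, ∀ i : Fin n,
      ((hχ.fourierChar_mul ξ).partialDeriv i).toL2 x =
        partialDeriv i ((fun x => (𝐞 ⟪x, ξ⟫ : ℂ)) * fun x => (χ x : ℂ)) x :=
    ae_all_iff.2 fun i => ((hχ.fourierChar_mul ξ).partialDeriv i).coeFn_toL2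
  filter_upwards [hgrad, (hχ.fourierChar_mul ξ).coeFn_toL2] with x h1 h2
  simp only [h1, h2, Complex.mul_conj, Complex.normSq_eq_norm_sq,
    norm_sq_partialDeriv_fourierChar_mul (hcd.differentiable (by simp)), mul_assoc (q x : ℂ)]
  rw [Pi.mul_apply, norm_mul, Circle.norm_coe, one_mul, Complex.norm_real, Real.norm_eq_abs,
    sq_abs, EuclideanSpace.norm_sq_eq]
  simp only [Real.norm_eq_abs, sq_abs]
  rw [← Complex.ofReal_sum, Finset.sum_add_distrib, ← Finset.sum_mul, ← Finset.mul_sum]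
  push_cast
  ring

/-- Cut-off plane waves are a subnormalised frame. -/
theorem setIntegral_norm_sq_inner_fourierChar_mul_le (hΩ : IsOpen Ω) (hb : Bornology.IsBounded Ω)
    (hχ : IsTestFunction Ω fun x => (χ x : ℂ)) (hχ1 : ∀ x, |χ x| ≤ 1)
    {s : Set (EuclideanSpace ℝ (Fin n))} (hs : Bornology.IsBounded s) (u : L2Space Ω) :
    IntegrableOn (fun ξ => ‖(inner ℂ u (hχ.fourierChar_mul ξ).toL2 : ℂ)‖ ^ 2) s ∧
    ∫ ξ in s, ‖(inner ℂ u (hχ.fourierChar_mul ξ).toL2 : ℂ)‖ ^ 2 ≤ ‖u‖ ^ 2 := by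
  have hmem : MemLp (fun x => (χ x : ℂ) * u x) 2 (volume.restrict Ω) := by
    refine (Lp.memLp u).of_le (hχ.continuous.aestronglyMeasurable.mul (Lp.aestronglyMeasurable u))
      (Eventually.of_forall fun x => ?_)
    rw [norm_mul, Complex.norm_real, Real.norm_eq_abs]
    exact mul_le_of_le_one_left (norm_nonneg _) (hχ1 x)
  have hnorm : ‖hmem.toLp _‖ ^ 2 ≤ ‖u‖ ^ 2 := by
    gcongr
    refine Lp.norm_le_norm_of_ae_le ?_
    filter_upwards [hmem.coeFn_toLp] with x hx
    rw [hx, norm_mul, Complex.norm_real, Real.norm_eq_abs]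
    exact mul_le_of_le_one_left (norm_nonneg _) (hχ1 x)
  -- The cut-off is moved to the other factor, so that Bessel for plane waves applies to `χ u`.
  have hinner : ∀ ξ, ‖(inner ℂ u (hχ.fourierChar_mul ξ).toL2 : ℂ)‖ =
      ‖(inner ℂ (planeWave hb ξ) (hmem.toLp _) : ℂ)‖ := by
    intro ξ
    rw [norm_inner_symm (planeWave hb ξ), L2.inner_def, L2.inner_def]
    congr 1
    refine integral_congr_ae ?_
    filter_upwards [hmem.coeFn_toLp, (hχ.fourierChar_mul ξ).coeFn_toL2, coeFn_planeWave hb ξ]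
      with x h1 h2 h3
    simp only [h1, h2, h3, RCLike.inner_apply, Pi.mul_apply, map_mul, Complex.conj_ofReal]
    ring
  simp only [hinner]
  refine ⟨?_, (setIntegral_norm_sq_inner_planeWave_le hΩ hb hs.measure_lt_top.ne _).trans hnorm⟩
  obtain ⟨r, hr⟩ := hs.subset_closedBall 0
  refine IntegrableOn.mono_set (ContinuousOn.integrableOn_compact (isCompact_closedBall 0 r) ?_) hr
  exact (((continuous_planeWave hb).inner continuous_const).norm.pow 2).continuousOn

/-- Lower bound for the Riesz means, by cut-off plane waves as trial functions. -/
theorem le_sum_max_sub_eigenvalue (hΩ : IsOpen Ω) (hb : Bornology.IsBounded Ω)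
    {q : EuclideanSpace ℝ (Fin n) → ℝ} (hq : Integrable q (volume.restrict Ω))
    {A : sobolevH10 Ω →L[ℂ] sobolevH10 Ω}
    (hform : ∀ w z, schrodingerForm Ω q (sobolevH10.val w) (fun i => sobolevH10.grad i w)
        (sobolevH10.val z) (fun i => sobolevH10.grad i z) = inner ℂ z (A w))
    (hsymm : ∀ w z, inner ℂ (A w) z = inner ℂ w (A z)) {C : ℝ}
    (hC : ∀ w : sobolevH10 Ω, -(C * ‖sobolevH10.val w‖ ^ 2) ≤ (inner ℂ w (A w) : ℂ).re)
    (b : HilbertBasis ℕ ℂ (L2Space Ω))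
    {w : ℕ → sobolevH10 Ω} (hw : ∀ j, sobolevH10.val (w j) = b j) {lam : ℕ → ℝ}
    (hlam : ∀ j z, inner ℂ z (A (w j)) = (lam j : ℂ) * inner ℂ (sobolevH10.val z) (b j))
    (hχ : IsTestFunction Ω fun x => (χ x : ℂ)) (hχ1 : ∀ x, |χ x| ≤ 1)
    {t : ℝ} (ht : 0 ≤ t) {N₀ : ℕ} (hN₀ : ∀ j, N₀ ≤ j → t ≤ lam j) :
    (∫ x in Ω, χ x ^ 2) * (∫ ξ : EuclideanSpace ℝ (Fin n), weylSymbol t ξ) -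
      (∫ x in Ω, ((∑ i, fderiv ℝ χ x (EuclideanSpace.single i 1) ^ 2) + q x * χ x ^ 2)) *
        volume.real (Metric.ball (0 : EuclideanSpace ℝ (Fin n)) (√t / (2 * Real.pi))) ≤
      ∑ j ∈ Finset.range N₀, max (t - lam j) 0 := by
  set B := Metric.ball (0 : EuclideanSpace ℝ (Fin n)) (√t / (2 * Real.pi)) with hB
  set X := ∫ x in Ω, χ x ^ 2
  set D := ∫ x in Ω, ((∑ i, fderiv ℝ χ x (EuclideanSpace.single i 1) ^ 2) + q x * χ x ^ 2)
  have hBb : Bornology.IsBounded B := Metric.isBounded_ball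
  have hBfin : IsFiniteMeasure (volume.restrict B) := hBb.isFiniteMeasure_restrict
  have hframe := fun u => setIntegral_norm_sq_inner_fourierChar_mul_le hΩ hb hχ hχ1 hBb u
  -- For the trial function `χ e_ξ` with `ξ` in the ball, `t‖v‖² - ⟪v, A v⟫` equals `X (t - 4π²|ξ|²)
  -- - D`; outside the ball the symbol vanishes.
  have hpt : ∀ ξ ∈ B, X * weylSymbol t ξ - D ≤ ∑ j ∈ Finset.range N₀, max (t - lam j) 0 *
        ‖(inner ℂ (b j) (hχ.fourierChar_mul ξ).toL2 : ℂ)‖ ^ 2 := by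
    intro ξ hξ
    refine le_trans (le_of_eq ?_) (mul_norm_sq_sub_form_le hsymm hC b hw hlam hN₀
      (sobolevH10.ofTest (hχ.fourierChar_mul ξ)))
    rw [← hform]
    simp only [sobolevH10.val_ofTest, sobolevH10.grad_ofTest]
    rw [schrodingerForm_fourierChar_mul hq hχ ξ, Complex.ofReal_re,
      hχ.norm_sq_toL2_fourierChar_mul,
      weylSymbol_eq_sub ht (by simpa using (mem_ball_zero_iff.1 hξ).le)]
    ring
  have hW : ∫ ξ : EuclideanSpace ℝ (Fin n), weylSymbol t ξ = ∫ ξ in B, weylSymbol t ξ := by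
    refine (setIntegral_eq_integral_of_forall_compl_eq_zero fun ξ hξ => ?_).symm
    refine weylSymbol_eq_zero ?_
    simpa [hB] using hξ
  have hWi : Integrable (fun ξ => weylSymbol t ξ) (volume.restrict B) :=
    (integrable_weylSymbol t).restrict
  calc X * (∫ ξ : EuclideanSpace ℝ (Fin n), weylSymbol t ξ) - D * volume.real B
      = ∫ ξ in B, (X * weylSymbol t ξ - D) := by
        rw [hW, integral_sub (hWi.const_mul X) (integrable_const D), integral_const_mul]
        simp [mul_comm]
    _ ≤ ∫ ξ in B, ∑ j ∈ Finset.range N₀, max (t - lam j) 0 *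
        ‖(inner ℂ (b j) (hχ.fourierChar_mul ξ).toL2 : ℂ)‖ ^ 2 :=
        setIntegral_mono_on ((hWi.const_mul X).sub (integrable_const D))
          (integrable_finsetSum _ fun j _ => (hframe (b j)).1.const_mul _)
          Metric.isOpen_ball.measurableSet hpt
    _ = ∑ j ∈ Finset.range N₀, max (t - lam j) 0 *
        ∫ ξ in B, ‖(inner ℂ (b j) (hχ.fourierChar_mul ξ).toL2 : ℂ)‖ ^ 2 := by
        rw [integral_finsetSum _ fun j _ => (hframe (b j)).1.const_mul _]
        simp only [integral_const_mul]
    _ ≤ _ := by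
        refine Finset.sum_le_sum fun j _ => mul_le_of_le_one_right (le_max_right _ _) ?_
        refine (hframe (b j)).2.trans ?_
        rw [b.orthonormal.1 j, one_pow]

/-- Smooth cut-offs exhaust `Ω` in measure. -/
theorem exists_cutoff (hΩ : IsOpen Ω) (hb : Bornology.IsBounded Ω) {δ : ℝ} (hδ : 0 < δ) :
    ∃ χ : EuclideanSpace ℝ (Fin n) → ℝ, IsTestFunction Ω (fun x => (χ x : ℂ)) ∧
      (∀ x, |χ x| ≤ 1) ∧ volume.real Ω - δ ≤ ∫ x in Ω, χ x ^ 2 := by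
  obtain ⟨K, hKΩ, hK, hKm⟩ := hΩ.measurableSet.exists_isCompact_lt_add
    (hb.measure_lt_top (μ := volume)).ne (ENNReal.ofReal_pos.2 hδ).ne'
  -- The cut-off is 1 on `K` and nonzero exactly on `interior L`; compactness of `L ⊆ Ω` keeps the
  -- closed support compact inside `Ω`.
  obtain ⟨L, hL, hKL, hLΩ⟩ := exists_compact_between hK hΩ hKΩ
  obtain ⟨f, hf, hfr, hfs, hf1⟩ := exists_contMDiff_support_eq_eq_one_iff
    (modelWithCornersSelf ℝ (EuclideanSpace ℝ (Fin n))) isOpen_interior hK.isClosed hKL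
  have hts : tsupport f ⊆ L := closure_minimal (by rw [hfs]; exact interior_subset) hL.isClosed
  have hfr' : ∀ x, 0 ≤ f x ∧ f x ≤ 1 := fun x => hfr ⟨x, rfl⟩
  have habs : ∀ x, |f x| ≤ 1 := fun x => by rw [abs_of_nonneg (hfr' x).1]; exact (hfr' x).2
  have hcs : HasCompactSupport f := hL.of_isClosed_subset (isClosed_tsupport _) hts
  refine ⟨f, ⟨Complex.ofRealCLM.contDiff.comp hf.contDiff,
    hcs.comp_left (g := fun t : ℝ => (t : ℂ)) (by simp),
    (closure_mono fun x hx => by simpa using hx).trans (hts.trans hLΩ)⟩, habs, ?_⟩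
  have hfc : Continuous fun x => f x ^ 2 := by
    have := hf.contDiff.continuous
    fun_prop
  have hi : Integrable (fun x => f x ^ 2) volume :=
    hfc.integrable_of_hasCompactSupport (hcs.comp_left (g := fun t : ℝ => t ^ 2) (by simp))
  have h1 : volume.real K ≤ ∫ x in Ω, f x ^ 2 := by
    calc volume.real K = ∫ x in K, (1 : ℝ) := by simp
      _ = ∫ x in K, f x ^ 2 := by
        refine setIntegral_congr_fun hK.measurableSet fun x hx => ?_
        simp [(hf1 x).1 hx]
      _ ≤ ∫ x in Ω, f x ^ 2 := setIntegral_mono_set hi.integrableOn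
        (Eventually.of_forall fun x => by positivity) hKΩ.eventuallyLE
  have h2 : volume.real Ω ≤ volume.real K + δ := by
    rw [← ENNReal.toReal_ofReal hδ.le, Measure.real, Measure.real,
      ← ENNReal.toReal_add hK.measure_lt_top.ne ENNReal.ofReal_ne_top]
    exact ENNReal.toReal_mono (ENNReal.add_ne_top.2 ⟨hK.measure_lt_top.ne, ENNReal.ofReal_ne_top⟩)
      hKm.le
  linarith

end LowerBoundRiesz

/-! ### A Tauberian theorem for Riesz means -/

section RieszMean

/-- The Riesz mean `∑ (t - λⱼ)₊` of a sequence. -/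
noncomputable def rieszMean (lam : ℕ → ℝ) (t : ℝ) : ℝ := ∑' j, max (t - lam j) 0

/-- Only finitely many terms are nonzero, so the value 0 that `tsum` assigns to divergent series
never interferes. -/
theorem rieszMean_eq_sum {lam : ℕ → ℝ} {t : ℝ} {N : ℕ} (hN : ∀ j, N ≤ j → t ≤ lam j) :
    rieszMean lam t = ∑ j ∈ Finset.range N, max (t - lam j) 0 := by
  refine tsum_eq_sum fun j hj => max_eq_right ?_
  linarith [hN j (by simpa using hj)]

theorem exists_forall_ge_le_of_tendsto {lam : ℕ → ℝ} (hlim : Tendsto lam atTop atTop) (t : ℝ) :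
    ∃ N : ℕ, ∀ j, N ≤ j → t ≤ lam j :=
  eventually_atTop.1 (hlim.eventually_ge_atTop t)

/-- To the right of `λ_k` the Riesz mean has slope at least `k + 1`, because `λ₀, …, λ_k` have all
been passed. -/
theorem add_one_mul_sub_le_rieszMean_sub {lam : ℕ → ℝ} (hmono : Monotone lam)
    (hlim : Tendsto lam atTop atTop) (k : ℕ) {b : ℝ} (hb : lam k ≤ b) :
    (k + 1) * (b - lam k) ≤ rieszMean lam b - rieszMean lam (lam k) := by
  obtain ⟨N, hN⟩ := exists_forall_ge_le_of_tendsto hlim b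
  have hN' : ∀ j, max N (k + 1) ≤ j → b ≤ lam j := fun j hj => hN j ((le_max_left _ _).trans hj)
  rw [rieszMean_eq_sum hN', rieszMean_eq_sum fun j hj => hb.trans (hN' j hj),
    ← Finset.sum_sub_distrib]
  calc ((k : ℝ) + 1) * (b - lam k) = ∑ j ∈ Finset.range (k + 1), (b - lam k) := by
        rw [Finset.sum_const, Finset.card_range, nsmul_eq_mul, Nat.cast_add_one]
    _ ≤ ∑ j ∈ Finset.range (k + 1), (max (b - lam j) 0 - max (lam k - lam j) 0) := by
        refine Finset.sum_le_sum fun j hj => ?_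
        have hj' : lam j ≤ lam k := hmono (by simpa [Nat.lt_succ_iff] using hj)
        rw [max_eq_left (by linarith), max_eq_left (by linarith)]
        linarith
    _ ≤ _ := by
        refine Finset.sum_le_sum_of_subset_of_nonneg
          (Finset.range_subset_range.2 (le_max_right _ _)) fun j _ _ => ?_
        exact sub_nonneg.2 (max_le_max_right 0 (by linarith))

/-- To the left of `λ_k` the slope is at most `k`: terms of index at least `k` vanish at both
arguments. -/
theorem rieszMean_sub_le_mul_sub {lam : ℕ → ℝ} (hmono : Monotone lam)
    (k : ℕ) {a : ℝ} (ha : a ≤ lam k) :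
    rieszMean lam (lam k) - rieszMean lam a ≤ k * (lam k - a) := by
  have hN : ∀ j, k ≤ j → lam k ≤ lam j := fun j hj => hmono hj
  rw [rieszMean_eq_sum hN, rieszMean_eq_sum fun j hj => ha.trans (hN j hj),
    ← Finset.sum_sub_distrib]
  calc ∑ j ∈ Finset.range k, (max (lam k - lam j) 0 - max (a - lam j) 0)
      ≤ ∑ j ∈ Finset.range k, (lam k - a) := by
        refine Finset.sum_le_sum fun j _ => ?_
        have := le_max_left (a - lam j) 0
        have := le_max_right (a - lam j) 0
        rcases max_choice (lam k - lam j) 0 with h | h <;> rw [h] <;> linarith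
    _ = k * (lam k - a) := by rw [Finset.sum_const, Finset.card_range, nsmul_eq_mul]

theorem tendsto_slope_rpow_one (s : ℝ) :
    Tendsto (fun θ : ℝ => ((1 + θ) ^ s - 1) / θ) (𝓝[≠] 0) (𝓝 s) := by
  have h : HasDerivAt (fun x : ℝ => x ^ s) (s * 1 ^ (s - 1)) 1 :=
    Real.hasDerivAt_rpow_const (Or.inl one_ne_zero)
  rw [Real.one_rpow, mul_one] at h
  have h2 := h.tendsto_slope_zero
  refine h2.congr fun θ => ?_
  simp [div_eq_inv_mul]

theorem tendsto_comp_mul_div_rpow {ρ : ℝ → ℝ} {s L c : ℝ} (hc : 0 < c)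
    (h : Tendsto (fun t => ρ t / t ^ s) atTop (𝓝 L)) :
    Tendsto (fun t => ρ (c * t) / t ^ s) atTop (𝓝 (L * c ^ s)) := by
  have h1 : Tendsto (fun t => ρ (c * t) / (c * t) ^ s * c ^ s) atTop (𝓝 (L * c ^ s)) :=
    (h.comp (tendsto_id.const_mul_atTop hc)).mul_const _
  refine h1.congr' ?_
  filter_upwards [eventually_gt_atTop 0] with t ht
  rw [Real.mul_rpow hc.le ht.le]
  have := (Real.rpow_pos_of_pos hc s).ne'
  have := (Real.rpow_pos_of_pos ht s).ne'
  field_simp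

/-- If `∑ (t - λⱼ)₊ ~ L tˢ` then `k + 1 ~ s L λₖ^(s-1)`. -/
theorem tendsto_add_one_div_rpow_of_rieszMean {lam : ℕ → ℝ} (hmono : Monotone lam)
    (hlim : Tendsto lam atTop atTop) {s L : ℝ}
    (hρ : Tendsto (fun t => rieszMean lam t / t ^ s) atTop (𝓝 L)) :
    Tendsto (fun k : ℕ => ((k : ℝ) + 1) / lam k ^ (s - 1)) atTop (𝓝 (L * s)) := by
  have hslope : Tendsto (fun θ : ℝ => L * (((1 + θ) ^ s - 1) / θ)) (𝓝[≠] 0) (𝓝 (L * s)) :=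
    (tendsto_slope_rpow_one s).const_mul L
  have hdiff : ∀ θ : ℝ, -1 < θ → Tendsto (fun k => (rieszMean lam ((1 + θ) * lam k) / lam k ^ s
      - rieszMean lam (lam k) / lam k ^ s) / θ) atTop (𝓝 (L * (((1 + θ) ^ s - 1) / θ))) := by
    intro θ hθ
    have h1 := ((tendsto_comp_mul_div_rpow (by linarith : 0 < 1 + θ) hρ).comp hlim).sub
      (hρ.comp hlim)
    rw [show L * (((1 + θ) ^ s - 1) / θ) = (L * (1 + θ) ^ s - L) / θ by ring]
    exact h1.div_const θ
  have hpow : ∀ k, 0 < lam k → lam k ^ s = lam k ^ (s - 1) * lam k := fun k hk => by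
    rw [Real.rpow_sub_one hk.ne', div_mul_cancel₀ _ hk.ne']
  -- Chords of the Riesz mean from `λ_k` to `(1 + θ)λ_k` have slope at most `k ≤ k + 1` for `θ < 0`
  -- and at least `k + 1` for `θ > 0`. Divided by `λ_k^(s-1)`, they tend to `L((1+θ)^s - 1)/θ`,
  -- which is close to `L s` for small `θ`.
  refine tendsto_order.2 ⟨fun a ha => ?_, fun a ha => ?_⟩
  · obtain ⟨θ, hθ, hθ0, hθ1⟩ : ∃ θ : ℝ, a < L * (((1 + θ) ^ s - 1) / θ) ∧ θ < 0 ∧ -1 < θ := by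
      have hleft := hslope.mono_left (nhdsLT_le_nhdsNE (0 : ℝ))
      have h1 : ∀ᶠ θ : ℝ in 𝓝[<] 0, θ < 0 := self_mem_nhdsWithin
      have h2 : ∀ᶠ θ : ℝ in 𝓝[<] 0, -1 < θ :=
        mem_nhdsWithin_of_mem_nhds (Ioi_mem_nhds (by norm_num))
      exact ((hleft.eventually (lt_mem_nhds ha)).and (h1.and h2)).exists
    filter_upwards [(hdiff θ hθ1).eventually (lt_mem_nhds hθ), hlim.eventually_gt_atTop 0]
      with k hk hk0
    refine hk.trans_le ?_
    have h := rieszMean_sub_le_mul_sub hmono k (a := (1 + θ) * lam k) (by nlinarith)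
    have hp := Real.rpow_pos_of_pos hk0 (s - 1)
    rw [← sub_div, div_le_iff_of_neg hθ0, le_div_iff₀ (Real.rpow_pos_of_pos hk0 s), hpow k hk0]
    calc ((k : ℝ) + 1) / lam k ^ (s - 1) * θ * (lam k ^ (s - 1) * lam k)
        = (k + 1) * θ * lam k := by field_simp
      _ ≤ _ := by nlinarith
  · obtain ⟨θ, hθ, hθ0⟩ : ∃ θ : ℝ, L * (((1 + θ) ^ s - 1) / θ) < a ∧ 0 < θ := by
      have hright := hslope.mono_left (nhdsGT_le_nhdsNE (0 : ℝ))
      exact ((hright.eventually (gt_mem_nhds ha)).and self_mem_nhdsWithin).exists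
    filter_upwards [(hdiff θ (by linarith)).eventually (gt_mem_nhds hθ),
      hlim.eventually_gt_atTop 0] with k hk hk0
    refine lt_of_le_of_lt ?_ hk
    have h := add_one_mul_sub_le_rieszMean_sub hmono hlim k (b := (1 + θ) * lam k) (by nlinarith)
    have hp := Real.rpow_pos_of_pos hk0 (s - 1)
    rw [← sub_div, le_div_iff₀ hθ0, le_div_iff₀ (Real.rpow_pos_of_pos hk0 s), hpow k hk0]
    calc ((k : ℝ) + 1) / lam k ^ (s - 1) * θ * (lam k ^ (s - 1) * lam k)
        = (k + 1) * θ * lam k := by field_simp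
      _ ≤ _ := by nlinarith

end RieszMean

/-! ### Weyl asymptotics -/

section Weyl

variable {n : ℕ} {Ω : Set (EuclideanSpace ℝ (Fin n))}

/-- The constant in `∫ (M - 4π²|ξ|²)₊ dξ = c M^(1 + n/2)`. -/
noncomputable def weylConst (n : ℕ) : ℝ :=
  volume.real (Metric.ball (0 : EuclideanSpace ℝ (Fin n)) 1) * (2 / (n + 2)) /
    (2 * Real.pi) ^ n

theorem volume_real_unitBall_pos (n : ℕ) :
    0 < volume.real (Metric.ball (0 : EuclideanSpace ℝ (Fin n)) 1) :=
  ENNReal.toReal_pos (Metric.measure_ball_pos volume _ one_pos).ne' measure_ball_lt_top.ne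

theorem volume_real_ball_eq_pow_mul {r : ℝ} (hr : 0 < r) :
    volume.real (Metric.ball (0 : EuclideanSpace ℝ (Fin n)) r) =
      r ^ n * volume.real (Metric.ball (0 : EuclideanSpace ℝ (Fin n)) 1) := by
  rw [Measure.real, Measure.addHaar_ball_of_pos _ _ hr, finrank_euclideanSpace, Fintype.card_fin,
    ENNReal.toReal_mul, ENNReal.toReal_ofReal (by positivity), Measure.real]

theorem weylConst_pos (n : ℕ) : 0 < weylConst n := by
  have := volume_real_unitBall_pos n
  unfold weylConst
  positivity

theorem sqrt_pow_eq_rpow {M : ℝ} (hM : 0 ≤ M) (n : ℕ) : √M ^ n = M ^ ((n : ℝ) / 2) := by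
  rw [Real.sqrt_eq_rpow, ← Real.rpow_natCast, ← Real.rpow_mul hM]
  ring_nf

theorem integral_weylSymbol_eq_rpow (hn : 0 < n) {M : ℝ} (hM : 0 < M) :
    ∫ ξ : EuclideanSpace ℝ (Fin n), weylSymbol M ξ = weylConst n * M ^ (1 + (n : ℝ) / 2) := by
  rw [integral_weylSymbol hn hM.le, div_pow, sqrt_pow_eq_rpow hM.le, Real.rpow_add hM,
    Real.rpow_one, weylConst]
  ring

/-- If all eigenvalues stayed below `t`, the first `N` would make the Riesz sum at `t + 1` at least
`N`, while its upper bound does not depend on `N`. -/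
theorem eigenvalue_tendsto_atTop (hb : Bornology.IsBounded Ω)
    {A : sobolevH10 Ω →L[ℂ] sobolevH10 Ω} {ε C : ℝ} (hε : ε < 1)
    (hA : ∀ w : sobolevH10 Ω,
        (1 - ε) * ∑ i, ‖sobolevH10.grad i w‖ ^ 2 - C * ‖sobolevH10.val w‖ ^ 2 ≤
          (inner ℂ w (A w) : ℂ).re)
    {w : ℕ → sobolevH10 Ω} (hw : Orthonormal ℂ fun i => sobolevH10.val (w i))
    {lam : ℕ → ℝ} (hlam : ∀ j, (inner ℂ (w j) (A (w j)) : ℂ).re = lam j)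
    (hmono : Monotone lam) : Tendsto lam atTop atTop := by
  refine tendsto_atTop_atTop_of_monotone hmono fun t => ?_
  by_contra! hcon
  obtain ⟨N, hN⟩ := exists_nat_gt ((1 - ε) * (volume.real Ω *
      ∫ ξ : EuclideanSpace ℝ (Fin n), weylSymbol ((t + 1 + C) / (1 - ε)) ξ))
  have h := sum_sub_eigenvalue_le hb hε hA hw hlam (Finset.range N) (t + 1)
  have h2 : (N : ℝ) ≤ ∑ j ∈ Finset.range N, (t + 1 - lam j) := by
    calc (N : ℝ) = ∑ j ∈ Finset.range N, (1 : ℝ) := by simp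
      _ ≤ _ := Finset.sum_le_sum fun j _ => by linarith [hcon j]
  linarith

theorem rieszMean_le (hn : 0 < n) (hb : Bornology.IsBounded Ω)
    {A : sobolevH10 Ω →L[ℂ] sobolevH10 Ω} {ε C : ℝ} (hε : ε < 1)
    (hA : ∀ w : sobolevH10 Ω,
        (1 - ε) * ∑ i, ‖sobolevH10.grad i w‖ ^ 2 - C * ‖sobolevH10.val w‖ ^ 2 ≤
          (inner ℂ w (A w) : ℂ).re)
    {w : ℕ → sobolevH10 Ω} (hw : Orthonormal ℂ fun i => sobolevH10.val (w i))
    {lam : ℕ → ℝ} (hlam : ∀ j, (inner ℂ (w j) (A (w j)) : ℂ).re = lam j)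
    (hmono : Monotone lam) {t : ℝ} (ht : 0 < t + C) :
    rieszMean lam t ≤ (1 - ε) * (volume.real Ω *
      (weylConst n * ((t + C) / (1 - ε)) ^ (1 + (n : ℝ) / 2))) := by
  obtain ⟨N, hN⟩ := exists_forall_ge_le_of_tendsto
    (eigenvalue_tendsto_atTop hb hε hA hw hlam hmono) t
  rw [rieszMean_eq_sum hN, ← integral_weylSymbol_eq_rpow hn (div_pos ht (by linarith))]
  -- The bound holds for every finite index set; selecting `λⱼ ≤ t` turns `t - λⱼ` into its positive
  -- part.
  refine le_trans (le_of_eq ?_) (sum_sub_eigenvalue_le hb hε hA hw hlam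
    ((Finset.range N).filter fun j => lam j ≤ t) t)
  rw [Finset.sum_filter]
  refine Finset.sum_congr rfl fun j _ => ?_
  split_ifs with h
  · exact max_eq_left (by linarith)
  · exact max_eq_right (by linarith)

/-- Leading asymptotics of the Riesz means of the Dirichlet eigenvalues. -/
theorem tendsto_rieszMean_div_rpow (hn : 3 ≤ n) (hΩ : IsOpen Ω) (hb : Bornology.IsBounded Ω)
    (hne : Ω.Nonempty) {q : EuclideanSpace ℝ (Fin n) → ℝ}
    (hq : MemLp q ((n : ℝ≥0∞) / 2) (volume.restrict Ω)) {lam : ℕ → ℝ}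
    (hlam : IsDirichletEigenvalueSequence Ω q lam) :
    Tendsto lam atTop atTop ∧
    Tendsto (fun t => rieszMean lam t / t ^ (1 + (n : ℝ) / 2)) atTop
      (𝓝 (volume.real Ω * weylConst n)) := by
  obtain ⟨A, hsymm, hform, hbound⟩ := exists_form_operator hn hq
  obtain ⟨hmono, b, heig⟩ := hlam
  choose w hw hwA using fun k => (isDirichletEigenvector_iff hform).1 (heig k)
  have hworth : Orthonormal ℂ fun i => sobolevH10.val (w i) := by
    simpa only [hw] using b.orthonormal
  have hdiag : ∀ j, (inner ℂ (w j) (A (w j)) : ℂ).re = lam j := by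
    intro j
    rw [hwA, hw, inner_self_eq_ofReal_norm_sq, b.orthonormal.1 j]
    simp
  have hn0 : 0 < n := by lia
  have hn' : (3 : ℝ) ≤ n := by exact_mod_cast hn
  have hO : 0 < volume.real Ω :=
    ENNReal.toReal_pos (hΩ.measure_pos volume hne).ne' hb.measure_lt_top.ne
  have hc := weylConst_pos n
  have hV := volume_real_unitBall_pos n
  set s : ℝ := 1 + (n : ℝ) / 2 with hs
  have hs0 : 0 < s := by positivity
  have hlim : Tendsto lam atTop atTop := by
    obtain ⟨C, -, hC⟩ := hbound (1 / 2) (by norm_num)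
    exact eigenvalue_tendsto_atTop hb (by norm_num) hC hworth hdiag hmono
  refine ⟨hlim, tendsto_order.2 ⟨fun a ha => ?_, fun a ha => ?_⟩⟩
  · have hq1 : Integrable q (volume.restrict Ω) := by
      have := hb.isFiniteMeasure_restrict
      refine hq.integrable ?_
      rw [ENNReal.le_div_iff_mul_le (by simp) (by simp)]
      norm_num
      exact_mod_cast (by lia : 2 ≤ n)
    -- With `ε = 1` the gradient term drops out and only semiboundedness remains.
    obtain ⟨C, -, hC⟩ := hbound 1 one_pos
    simp only [sub_self, zero_mul, zero_sub] at hC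
    -- This `δ` costs half the gap: `X * weylConst n` stays above the midpoint of `a` and
    -- `volume.real Ω * weylConst n`.
    have hδ : 0 < (volume.real Ω * weylConst n - a) / (2 * weylConst n) :=
      div_pos (by linarith) (by positivity)
    obtain ⟨χ, hχ, hχ1, hχX⟩ := exists_cutoff hΩ hb hδ
    set X := ∫ x in Ω, χ x ^ 2
    set D := ∫ x in Ω, ((∑ i, fderiv ℝ χ x (EuclideanSpace.single i 1) ^ 2) + q x * χ x ^ 2)
    set V := volume.real (Metric.ball (0 : EuclideanSpace ℝ (Fin n)) 1)
    have hX : a < X * weylConst n := by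
      have := mul_le_mul_of_nonneg_right hχX hc.le
      have e : (volume.real Ω - (volume.real Ω * weylConst n - a) / (2 * weylConst n))
          * weylConst n = (volume.real Ω * weylConst n + a) / 2 := by
        field_simp
        ring
      linarith
    have hlow : ∀ t : ℝ, 0 < t →
        X * weylConst n - D * V / (2 * Real.pi) ^ n * t⁻¹ ≤ rieszMean lam t / t ^ s := by
      intro t ht
      obtain ⟨N, hN⟩ := exists_forall_ge_le_of_tendsto hlim t
      have h := le_sum_max_sub_eigenvalue hΩ hb hq1 hform hsymm hC b hw hwA hχ hχ1 ht.le hN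
      rw [← rieszMean_eq_sum hN, integral_weylSymbol_eq_rpow hn0 ht,
        volume_real_ball_eq_pow_mul (by positivity), div_pow, sqrt_pow_eq_rpow ht.le] at h
      have hts := Real.rpow_pos_of_pos ht s
      rw [le_div_iff₀ hts]
      refine le_trans (le_of_eq ?_) h
      have e : t ^ s = t * t ^ ((n : ℝ) / 2) := by rw [hs, Real.rpow_add ht, Real.rpow_one]
      change _ = X * (weylConst n * t ^ s) - D * (t ^ ((n : ℝ) / 2) / (2 * Real.pi) ^ n * V)
      rw [e]
      field_simp
    have hlim2 : Tendsto (fun t : ℝ => X * weylConst n - D * V / (2 * Real.pi) ^ n * t⁻¹) atTop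
        (𝓝 (X * weylConst n - D * V / (2 * Real.pi) ^ n * 0)) :=
      (tendsto_inv_atTop_zero.const_mul _).const_sub _
    rw [mul_zero, sub_zero] at hlim2
    filter_upwards [hlim2.eventually (lt_mem_nhds hX), eventually_gt_atTop 0] with t h1 h2
    exact h1.trans_le (hlow t h2)
  -- The loss `ε` is fixed before `t → ∞`; the constant `C` it produces enters only through `(1 +
  -- C/t)^s → 1`.
  · obtain ⟨ε, hεa, hε0, hε1⟩ : ∃ ε : ℝ,
        (1 - ε) * (volume.real Ω * (weylConst n * (1 / (1 - ε)) ^ s)) < a ∧ 0 < ε ∧ ε < 1 := by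
      have hcont : Tendsto (fun ε : ℝ =>
          (1 - ε) * (volume.real Ω * (weylConst n * (1 / (1 - ε)) ^ s))) (𝓝[>] 0)
          (𝓝 ((1 - 0) * (volume.real Ω * (weylConst n * (1 / (1 - 0)) ^ s)))) := by
        refine ContinuousAt.tendsto ?_ |>.mono_left nhdsWithin_le_nhds
        have h1 : ContinuousAt (fun ε : ℝ => 1 / (1 - ε)) 0 :=
          continuousAt_const.div (by fun_prop) (by norm_num)
        have h2 : ContinuousAt (fun ε : ℝ => (1 / (1 - ε)) ^ s) 0 :=
          h1.rpow_const (Or.inl (by norm_num))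
        fun_prop
      have e : (1 - 0) * (volume.real Ω * (weylConst n * (1 / (1 - 0)) ^ s))
          = volume.real Ω * weylConst n := by simp
      rw [e] at hcont
      have h1 : ∀ᶠ ε : ℝ in 𝓝[>] 0, 0 < ε := self_mem_nhdsWithin
      have h2 : ∀ᶠ ε : ℝ in 𝓝[>] 0, ε < 1 :=
        mem_nhdsWithin_of_mem_nhds (Iio_mem_nhds (by norm_num))
      exact ((hcont.eventually (gt_mem_nhds ha)).and (h1.and h2)).exists
    obtain ⟨C, hC0, hC⟩ := hbound ε hε0
    have hε' : 0 < 1 - ε := by linarith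
    have hup : ∀ t : ℝ, 0 < t → rieszMean lam t / t ^ s ≤
        (1 - ε) * (volume.real Ω * (weylConst n * (1 / (1 - ε)) ^ s)) * (1 + C * t⁻¹) ^ s := by
      intro t ht
      have h := rieszMean_le hn0 hb hε1 hC hworth hdiag hmono (t := t) (by linarith)
      rw [div_le_iff₀ (Real.rpow_pos_of_pos ht s)]
      refine h.trans (le_of_eq ?_)
      have e : (t + C) / (1 - ε) = 1 / (1 - ε) * (1 + C * t⁻¹) * t := by
        field_simp
      rw [e, Real.mul_rpow (by positivity) ht.le, Real.mul_rpow (by positivity) (by positivity)]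
      ring
    have hlim3 : Tendsto (fun t : ℝ => (1 - ε) * (volume.real Ω * (weylConst n *
        (1 / (1 - ε)) ^ s)) * (1 + C * t⁻¹) ^ s) atTop (𝓝 ((1 - ε) * (volume.real Ω *
        (weylConst n * (1 / (1 - ε)) ^ s)) * (1 + C * 0) ^ s)) :=
      (((tendsto_inv_atTop_zero.const_mul C).const_add 1).rpow_const (Or.inr hs0.le)).const_mul _
    rw [mul_zero, add_zero, Real.one_rpow, mul_one] at hlim3
    filter_upwards [hlim3.eventually (gt_mem_nhds hεa), eventually_gt_atTop 0] with t h1 h2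
    exact (hup t h2).trans_lt h1

/-- **Weyl's law** for the Dirichlet eigenvalues of a Schrödinger operator. -/
theorem dirichletEigenvalue_isEquivalent (hn : 3 ≤ n) (hΩ : IsOpen Ω) (hb : Bornology.IsBounded Ω)
    (hne : Ω.Nonempty) {q : EuclideanSpace ℝ (Fin n) → ℝ}
    (hq : MemLp q ((n : ℝ≥0∞) / 2) (volume.restrict Ω)) {lam : ℕ → ℝ}
    (hlam : IsDirichletEigenvalueSequence Ω q lam) :
    lam ~[atTop] fun k : ℕ =>
        4 * Real.pi ^ 2 /
            (volume.real (Metric.ball (0 : EuclideanSpace ℝ (Fin n)) 1) * volume.real Ω)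
              ^ (2 / (n : ℝ)) *
          ((k : ℝ) + 1) ^ (2 / (n : ℝ)) := by
  obtain ⟨hlim, hρ⟩ := tendsto_rieszMean_div_rpow hn hΩ hb hne hq hlam
  have hO : 0 < volume.real Ω :=
    ENNReal.toReal_pos (hΩ.measure_pos volume hne).ne' hb.measure_lt_top.ne
  have hV := volume_real_unitBall_pos n
  have hn' : (0 : ℝ) < n := by exact_mod_cast (by lia : 0 < n)
  have h := tendsto_add_one_div_rpow_of_rieszMean hlam.1 hlim hρ
  have hpi := Real.two_pi_pos
  set V := volume.real (Metric.ball (0 : EuclideanSpace ℝ (Fin n)) 1)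
  set O := volume.real Ω
  -- The exponent `s = 1 + n/2` brought down by differentiation cancels the factor `2/(n+2)` in
  -- `weylConst`.
  have hK : O * weylConst n * (1 + (n : ℝ) / 2) = V * O / (2 * Real.pi) ^ n := by
    unfold weylConst
    field_simp
    ring
  rw [hK, add_sub_cancel_left] at h
  have h2 := h.rpow_const (p := 2 / (n : ℝ)) (Or.inr (by positivity))
  have hKpow : (V * O / (2 * Real.pi) ^ n) ^ (2 / (n : ℝ)) =
      (V * O) ^ (2 / (n : ℝ)) / (4 * Real.pi ^ 2) := by
    rw [Real.div_rpow (by positivity) (by positivity), ← Real.rpow_natCast (2 * Real.pi) n,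
      ← Real.rpow_mul hpi.le, mul_div_cancel₀ _ hn'.ne', Real.rpow_two]
    ring
  rw [hKpow] at h2
  have hVO := Real.rpow_pos_of_pos (mul_pos hV hO) (2 / (n : ℝ))
  rw [isEquivalent_iff_tendsto_one (Eventually.of_forall fun k => by positivity)]
  have h3 := (h2.const_mul (4 * Real.pi ^ 2 / (V * O) ^ (2 / (n : ℝ)))).inv₀ (by positivity)
  have e1 : (4 * Real.pi ^ 2 / (V * O) ^ (2 / (n : ℝ)) *
      ((V * O) ^ (2 / (n : ℝ)) / (4 * Real.pi ^ 2)))⁻¹ = 1 := by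
    field_simp
  rw [e1] at h3
  refine h3.congr' ?_
  -- Finitely many eigenvalues may be nonpositive; the power law cancelling the exponents `n/2` and
  -- `2/n` is applied only for positive ones.
  filter_upwards [hlim.eventually_gt_atTop 0] with k hk
  rw [Pi.div_apply, Real.div_rpow (by positivity) (by positivity), ← Real.rpow_mul hk.le]
  have e2 : (n : ℝ) / 2 * (2 / n) = 1 := by field_simp
  rw [e2, Real.rpow_one]
  have hk1 : 0 < ((k : ℝ) + 1) ^ (2 / (n : ℝ)) := by positivity
  field_simp

end Weyl

/-! ### Compactness of the embedding `H¹₀(Ω) → L²(Ω)` -/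

section Compactness

/-- A bounded operator that is small up to finitely many functionals is compact. -/
theorem isCompactOperator_of_forall_exists_finset {H L : Type*} [NormedAddCommGroup H]
    [InnerProductSpace ℂ H] [NormedAddCommGroup L] [InnerProductSpace ℂ L] [CompleteSpace L]
    (J : H →L[ℂ] L)
    (h : ∀ ε : ℝ, 0 < ε → ∃ (s : Finset L) (K : ℝ), 0 ≤ K ∧
      ∀ w, ‖J w‖ ^ 2 ≤ K * ∑ f ∈ s, ‖(inner ℂ f (J w) : ℂ)‖ ^ 2 + ε * ‖w‖ ^ 2) :
    IsCompactOperator J := by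
  have key : TotallyBounded (J '' Metric.closedBall 0 1) := by
    refine Metric.totallyBounded_iff.2 fun ε hε => ?_
    -- Differences of points of the unit ball have norm at most 2, so `ε²/16` contributes at most
    -- `ε²/4`. The radius `δ` below makes the finite-dimensional part contribute at most `ε²/4` too.
    obtain ⟨s, K, hK, hs⟩ := h (ε ^ 2 / 16) (by positivity)
    let P : H →L[ℂ] (s → ℂ) := ContinuousLinearMap.pi fun f => (innerSL ℂ (f : L)).comp J
    have hP : ∀ w, ‖J w‖ ^ 2 ≤ K * s.card * ‖P w‖ ^ 2 + ε ^ 2 / 16 * ‖w‖ ^ 2 := by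
      intro w
      refine (hs w).trans ?_
      rw [mul_assoc]
      gcongr
      rw [← nsmul_eq_mul]
      refine Finset.sum_le_card_nsmul _ _ _ fun f hf => ?_
      gcongr
      exact norm_le_pi_norm (P w) ⟨f, hf⟩
    have hbdd : TotallyBounded (P '' Metric.closedBall 0 1) :=
      ((P.lipschitz.isBounded_image Metric.isBounded_closedBall).isCompact_closure.totallyBounded
        ).subset subset_closure
    set δ : ℝ := ε / (2 * √(K * s.card + 1)) with hδ
    have hδ0 : 0 < δ := by positivity
    obtain ⟨t, hts, htf, ht⟩ := Metric.finite_approx_of_totallyBounded hbdd δ hδ0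
    choose! g hg using fun y (hy : y ∈ t) => hts hy
    refine ⟨(fun y => J (g y)) '' t, htf.image _, ?_⟩
    rintro _ ⟨w, hw, rfl⟩
    obtain ⟨y, hy, hwy⟩ := Set.mem_iUnion₂.1 (ht ⟨w, hw, rfl⟩)
    refine Set.mem_iUnion₂.2 ⟨_, ⟨y, hy, rfl⟩, ?_⟩
    rw [Metric.mem_ball, dist_eq_norm] at hwy ⊢
    rw [← map_sub]
    have h1 := hP (w - g y)
    have h2 : ‖P (w - g y)‖ < δ := by rwa [map_sub, (hg y hy).2]
    have h3 : ‖w - g y‖ ≤ 2 := by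
      have e1 := mem_closedBall_zero_iff.1 hw
      have e2 := mem_closedBall_zero_iff.1 (hg y hy).1
      linarith [norm_sub_le w (g y)]
    have h4 : K * s.card * ‖P (w - g y)‖ ^ 2 ≤ ε ^ 2 / 4 := by
      have e1 : ‖P (w - g y)‖ ^ 2 ≤ δ ^ 2 := by gcongr
      have e2 : (K * s.card + 1) * δ ^ 2 = ε ^ 2 / 4 := by
        rw [hδ, div_pow, mul_pow, Real.sq_sqrt (by positivity)]
        field_simp
        norm_num
      have e3 : K * s.card * ‖P (w - g y)‖ ^ 2 ≤ K * s.card * δ ^ 2 := by gcongr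
      nlinarith
    have h5 : ε ^ 2 / 16 * ‖w - g y‖ ^ 2 ≤ ε ^ 2 / 4 := by
      have : ‖w - g y‖ ^ 2 ≤ 2 ^ 2 := by gcongr
      nlinarith [sq_nonneg ε]
    refine lt_of_pow_lt_pow_left₀ 2 hε.le ?_
    have : 0 < ε ^ 2 := by positivity
    linarith
  refine (isCompactOperator_iff_isCompact_closure_image_closedBall (J : H →ₗ[ℂ] L) one_pos).2 ?_
  exact key.closure.isCompact_of_isClosed isClosed_closure

variable {n : ℕ} {Ω : Set (EuclideanSpace ℝ (Fin n))}

/-- **Rellich's theorem** for `H¹₀`. -/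
theorem isCompactOperator_val (hb : Bornology.IsBounded Ω) :
    IsCompactOperator (sobolevH10.val (Ω := Ω)) := by
  refine isCompactOperator_of_forall_exists_finset _ fun ε hε => ?_
  -- Frequencies above `√M/2π` are paid for by the gradient, with a factor `1/M`; the plane waves
  -- below it form a compact set with a finite `δ`-net. `δ` is chosen with `2Wδ² ≤ 1`, so the net
  -- costs at most a further `‖u‖²/M`.
  set M : ℝ := 2 / ε with hM
  have hM0 : 0 < M := by positivity
  set W : ℝ := ∫ ξ : EuclideanSpace ℝ (Fin n), weylSymbol M ξ with hW
  have hW0 : 0 ≤ W := integral_nonneg fun ξ => weylSymbol_nonneg _ _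
  set δ : ℝ := 1 / √(2 * (W + 1)) with hδ
  have hδ0 : 0 < δ := by positivity
  have hδ2 : 2 * W * δ ^ 2 ≤ 1 := by
    rw [hδ, div_pow, Real.sq_sqrt (by positivity), one_pow, mul_one_div, div_le_one (by positivity)]
    linarith
  have hcpt : IsCompact (planeWave hb '' Metric.closedBall 0 (√M / (2 * Real.pi))) :=
    (isCompact_closedBall _ _).image (continuous_planeWave hb)
  obtain ⟨t, -, htf, ht⟩ := Metric.finite_approx_of_totallyBounded hcpt.totallyBounded δ hδ0
  refine ⟨htf.toFinset, 2 * W / M, by positivity, fun w => ?_⟩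
  set u := sobolevH10.val w
  set S : ℝ := ∑ f ∈ htf.toFinset, ‖(inner ℂ f u : ℂ)‖ ^ 2 with hS
  have hS0 : 0 ≤ S := Finset.sum_nonneg fun _ _ => by positivity
  have hpt : ∀ ξ : EuclideanSpace ℝ (Fin n), weylSymbol M ξ *
      ‖(inner ℂ (planeWave hb ξ) u : ℂ)‖ ^ 2 ≤ weylSymbol M ξ * (2 * S + 2 * δ ^ 2 * ‖u‖ ^ 2) := by
    intro ξ
    by_cases hξ : ‖ξ‖ ≤ √M / (2 * Real.pi)
    · refine mul_le_mul_of_nonneg_left ?_ (weylSymbol_nonneg _ _)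
      obtain ⟨f, hf, hfξ⟩ := Set.mem_iUnion₂.1
        (ht ⟨ξ, mem_closedBall_zero_iff.2 hξ, rfl⟩)
      rw [Metric.mem_ball, dist_eq_norm] at hfξ
      have e1 : ‖(inner ℂ f u : ℂ)‖ ^ 2 ≤ S :=
        Finset.single_le_sum (f := fun f => ‖(inner ℂ f u : ℂ)‖ ^ 2)
          (fun _ _ => by positivity) (htf.mem_toFinset.2 hf)
      have e2 : ‖(inner ℂ (planeWave hb ξ) u : ℂ)‖ ≤ ‖(inner ℂ f u : ℂ)‖ + δ * ‖u‖ := by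
        have : (inner ℂ (planeWave hb ξ) u : ℂ) =
            inner ℂ f u + inner ℂ (planeWave hb ξ - f) u := by
          rw [inner_sub_left]; ring
        rw [this]
        refine (norm_add_le _ _).trans (add_le_add_right ?_ _)
        exact (norm_inner_le_norm _ _).trans (by gcongr)
      calc ‖(inner ℂ (planeWave hb ξ) u : ℂ)‖ ^ 2
          ≤ (‖(inner ℂ f u : ℂ)‖ + δ * ‖u‖) ^ 2 := by gcongr
        _ ≤ 2 * ‖(inner ℂ f u : ℂ)‖ ^ 2 + 2 * (δ * ‖u‖) ^ 2 := by
          nlinarith [sq_nonneg (‖(inner ℂ f u : ℂ)‖ - δ * ‖u‖)]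
        _ ≤ _ := by nlinarith
    · rw [weylSymbol_eq_zero (not_le.1 hξ).le, zero_mul, zero_mul]
  have hint : ∫ ξ, weylSymbol M ξ * ‖(inner ℂ (planeWave hb ξ) u : ℂ)‖ ^ 2 ≤
      W * (2 * S + 2 * δ ^ 2 * ‖u‖ ^ 2) := by
    rw [hW, ← integral_mul_const]
    exact integral_mono_of_nonneg
      (Eventually.of_forall fun ξ => mul_nonneg (weylSymbol_nonneg _ _) (by positivity))
      ((integrable_weylSymbol M).mul_const _) (Eventually.of_forall hpt)
  have hK := (mul_norm_sq_sub_grad_le hb M w).trans hint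
  have hn := sobolevH10.norm_sq_eq w
  have hgrad := sum_norm_grad_sq_nonneg w
  have hfin : M * ‖u‖ ^ 2 ≤ 2 * W * S + 2 * ‖w‖ ^ 2 := by
    have e : 2 * W * δ ^ 2 * ‖u‖ ^ 2 ≤ 1 * ‖u‖ ^ 2 := by gcongr
    nlinarith [sq_nonneg ‖u‖]
  have hε' : ε = 2 / M := by rw [hM]; field_simp
  rw [hε', div_mul_eq_mul_div, div_mul_eq_mul_div, ← add_div, le_div_iff₀ hM0]
  linarith

end Compactness

/-! ### Spectral theorem for forms with compact embedding -/

section FormSpectrum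

/-- A real function with finite sublevel sets on an infinite type can be enumerated in
nondecreasing order. -/
theorem exists_equiv_nat_monotone {ι : Type*} [Infinite ι] (f : ι → ℝ)
    (hf : ∀ t, {i | f i ≤ t}.Finite) : ∃ e : ℕ ≃ ι, Monotone (f ∘ e) := by
  classical
  have hcount : Countable ι := by
    rw [← Set.countable_univ_iff]
    refine (Set.countable_iUnion fun m : ℕ => (hf m).countable).mono fun i _ => ?_
    obtain ⟨m, hm⟩ := exists_nat_ge (f i)
    exact Set.mem_iUnion.2 ⟨m, hm⟩
  obtain ⟨enc, henc⟩ := exists_injective_nat ι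
  -- An injective numbering breaks ties, and `r` is the rank for the resulting strict order. It
  -- suffices that the ranks form an infinite subset of `ℕ`, which is order isomorphic to `ℕ`.
  let key : ι → ℝ ×ₗ ℕ := fun i => toLex (f i, enc i)
  have hkey : ∀ i j, key i ≤ key j → f i ≤ f j := by
    intro i j h
    rcases Prod.Lex.toLex_le_toLex.1 h with h | h
    · exact h.le
    · exact h.1.le
  have hkinj : Function.Injective key := fun i j h => henc (congrArg Prod.snd (toLex.injective h))
  have hfin : ∀ i, {j | key j < key i}.Finite := fun i =>
    (hf (f i)).subset fun j hj => hkey j i (le_of_lt hj)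
  let r : ι → ℕ := fun i => {j | key j < key i}.ncard
  have hr : ∀ i j, key i < key j → r i < r j := fun i j h =>
    Set.ncard_lt_ncard ⟨fun k hk => lt_trans hk h, fun hsub => lt_irrefl (key i) (hsub h)⟩ (hfin j)
  have hrinj : Function.Injective r := by
    intro i j hij
    by_contra hne
    rcases lt_or_gt_of_ne fun h => hne (hkinj h) with h | h
    · exact (hr i j h).ne hij
    · exact (hr j i h).ne' hij
  have : Infinite (Set.range r) := Set.infinite_coe_iff.2 (Set.infinite_range_of_injective hrinj)
  let e₁ := Nat.Subtype.orderIsoOfNat (Set.range r)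
  refine ⟨e₁.toEquiv.trans (Equiv.ofInjective r hrinj).symm, fun k l hkl => ?_⟩
  refine hkey _ _ (not_lt.1 fun h => ?_)
  have h2 := hr _ _ h
  have hval : ∀ m, r ((Equiv.ofInjective r hrinj).symm (e₁ m)) = e₁ m := fun m =>
    congrArg Subtype.val ((Equiv.ofInjective r hrinj).apply_symm_apply (e₁ m))
  have h3 : (e₁ k : ℕ) ≤ e₁ l := e₁.monotone hkl
  change r ((Equiv.ofInjective r hrinj).symm (e₁ l)) <
    r ((Equiv.ofInjective r hrinj).symm (e₁ k)) at h2
  rw [hval, hval] at h2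
  exact absurd h2 (not_lt.2 h3)

variable {H L : Type*} [NormedAddCommGroup H] [InnerProductSpace ℂ H] [CompleteSpace H]
  [NormedAddCommGroup L] [InnerProductSpace ℂ L] [CompleteSpace L]

/-- A compact symmetric operator without kernel has a complete orthonormal system of
eigenvectors. -/
theorem exists_orthonormal_eigenvectors {T : L →L[ℂ] L} (hT : IsCompactOperator T)
    (hsymm : (T : L →ₗ[ℂ] L).IsSymmetric) (hker : ∀ f, T f = 0 → f = 0) :
    ∃ (ι : Type) (v : ι → L) (μ : ι → ℝ), Orthonormal ℂ v ∧
      (Submodule.span ℂ (Set.range v))ᗮ = ⊥ ∧ ∀ i, μ i ≠ 0 ∧ T (v i) = (μ i : ℂ) • v i := by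
  have hzero : Module.End.eigenspace (T : L →ₗ[ℂ] L) 0 = ⊥ := by
    rw [Submodule.eq_bot_iff]
    intro f hf
    refine hker f ?_
    have := Module.End.mem_eigenspace_iff.1 hf
    simpa using this
  have hfd : ∀ μ : ℂ, FiniteDimensional ℂ (Module.End.eigenspace (T : L →ₗ[ℂ] L) μ) := by
    intro μ
    rcases eq_or_ne μ 0 with rfl | hμ
    · rw [hzero]
      infer_instance
    · exact ContinuousLinearMap.finite_dimensional_eigenspace hT μ hμ
  -- Orthonormal bases of all eigenspaces are glued over every `μ : ℂ`; a `μ` that is not an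
  -- eigenvalue contributes the empty index type `Fin 0`.
  let B := fun μ : ℂ => stdOrthonormalBasis ℂ (Module.End.eigenspace (T : L →ₗ[ℂ] L) μ)
  let v : (Σ μ : ℂ, Fin (Module.finrank ℂ (Module.End.eigenspace (T : L →ₗ[ℂ] L) μ))) → L :=
    fun a => (B a.1 a.2 : L)
  have hv : Orthonormal ℂ v :=
    hsymm.orthogonalFamily_eigenspaces.orthonormal_sigma_orthonormal fun μ => (B μ).orthonormal
  have heig : ∀ a, T (v a) = a.1 • v a := fun a =>
    Module.End.mem_eigenspace_iff.1 (B a.1 a.2).2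
  have hne : ∀ a, v a ≠ 0 := fun a => hv.ne_zero a
  have hreal : ∀ a : Σ μ : ℂ, Fin (Module.finrank ℂ (Module.End.eigenspace (T : L →ₗ[ℂ] L) μ)),
      ((a.1.re : ℝ) : ℂ) = a.1 := by
    intro a
    refine Complex.conj_eq_iff_re.1 (hsymm.conj_eigenvalue_eq_self ?_)
    exact Module.End.hasEigenvalue_of_hasEigenvector ⟨(B a.1 a.2).2, hne a⟩
  refine ⟨_, v, fun a => a.1.re, hv, ?_, fun a => ⟨fun h0 => hne a ?_, ?_⟩⟩
  · rw [eq_bot_iff, ← ContinuousLinearMap.orthogonalComplement_iSup_eigenspaces_eq_bot hT hsymm]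
    refine Submodule.orthogonal_le (iSup_le fun μ f hf => ?_)
    have h1 := (B μ).sum_repr ⟨f, hf⟩
    have h2 : f = ∑ i, (B μ).repr ⟨f, hf⟩ i • (B μ i : L) := by
      have := congrArg Subtype.val h1
      simpa using this.symm
    rw [h2]
    exact Submodule.sum_mem _ fun i _ => Submodule.smul_mem _ _
      (Submodule.subset_span ⟨⟨μ, i⟩, rfl⟩)
  · refine hker _ ?_
    replace h0 : a.1.re = 0 := h0
    rw [heig a, ← hreal a, h0, Complex.ofReal_zero, zero_smul]
  · rw [hreal a]
    exact heig a

/-- A symmetric form that is coercive modulo a compact, dense embedding `J` has a complete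
orthonormal system of eigenvectors. -/
theorem exists_form_eigenvectors {J : H →L[ℂ] L} (hJ : IsCompactOperator J)
    (hdense : ∀ f : L, (∀ z, inner ℂ (J z) f = 0) → f = 0) {A : H →L[ℂ] H}
    (hA : ∀ w z, inner ℂ (A w) z = inner ℂ w (A z)) {c C : ℝ} (hc : 0 < c)
    (hcoer : ∀ w, c * ‖w‖ ^ 2 ≤ (inner ℂ w (A w) : ℂ).re + C * ‖J w‖ ^ 2) :
    ∃ (ι : Type) (w : ι → H) (lam : ι → ℝ), Orthonormal ℂ (fun i => J (w i)) ∧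
      (Submodule.span ℂ (Set.range fun i => J (w i)))ᗮ = ⊥ ∧
      ∀ i z, inner ℂ z (A (w i)) = (lam i : ℂ) * inner ℂ (J z) (J (w i)) := by
  set J' := ContinuousLinearMap.adjoint J with hJ'
  -- `B = A + C J*J` is coercive, hence invertible by Lax–Milgram.
  obtain ⟨B, hB⟩ : ∃ B : H →L[ℂ] H, ∀ z w,
      inner ℂ z (B w) = inner ℂ z (A w) + (C : ℂ) * inner ℂ (J z) (J w) := by
    refine ⟨A + (C : ℂ) • J'.comp J, fun z w => ?_⟩
    simp [hJ', ContinuousLinearMap.adjoint_inner_right]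
  have hBsymm : ∀ w z, inner ℂ (B w) z = inner ℂ w (B z) := by
    intro w z
    rw [← inner_conj_symm, hB, hB, map_add, map_mul, Complex.conj_ofReal, inner_conj_symm,
      inner_conj_symm, hA]
  have hBcoer : ∀ w, c * ‖w‖ ^ 2 ≤ (inner ℂ w (B w) : ℂ).re := by
    intro w
    refine (hcoer w).trans (le_of_eq ?_)
    rw [hB, Complex.add_re, Complex.re_ofReal_mul, inner_self_eq_ofReal_norm_sq, Complex.ofReal_re]
  have hBunit : IsUnit B := by
    refine B.isUnit_of_forall_le_norm_inner_map (c := c.toNNReal) (Real.toNNReal_pos.2 hc)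
      fun w => ?_
    rw [Real.coe_toNNReal _ hc.le, mul_comm, hBsymm]
    exact (hBcoer w).trans (Complex.re_le_norm _)
  obtain ⟨B', hBB'⟩ : ∃ B' : H →L[ℂ] H, ∀ x, B (B' x) = x := by
    obtain ⟨u, rfl⟩ := hBunit
    exact ⟨(u⁻¹ : (H →L[ℂ] H)ˣ), fun x => DFunLike.congr_fun u.mul_inv x⟩
  have hB'symm : ∀ x y, inner ℂ (B' x) y = inner ℂ x (B' y) := by
    intro x y
    conv_lhs => rw [← hBB' y]
    rw [← hBsymm, hBB']
  -- `T` is the solution operator: `T f = J u` where `⟪z, B u⟫ = ⟪J z, f⟫` for all `z`. Its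
  -- eigenvalue `μ` corresponds to the eigenvalue `μ⁻¹ - C` of the form.
  set T : L →L[ℂ] L := J.comp (B'.comp J') with hT
  have hTc : IsCompactOperator T := hJ.comp_clm (B'.comp J')
  have hTsymm : (T : L →ₗ[ℂ] L).IsSymmetric := by
    intro f g
    change inner ℂ (J (B' (J' f))) g = inner ℂ f (J (B' (J' g)))
    rw [← ContinuousLinearMap.adjoint_inner_right J, ← hJ', hB'symm, hJ',
      ContinuousLinearMap.adjoint_inner_left]
  have hTker : ∀ f, T f = 0 → f = 0 := by
    intro f hf
    -- The energy of `B⁻¹J*f` is `⟪T f, f⟫ = 0`; coercivity gives `J*f = 0`, so `f` is orthogonal to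
    -- the dense range of `J`.
    have h1 : inner ℂ (B' (J' f)) (B (B' (J' f))) = (0 : ℂ) := by
      rw [hBB', hJ', ContinuousLinearMap.adjoint_inner_right]
      change inner ℂ (T f) f = (0 : ℂ)
      rw [hf, inner_zero_left]
    have h2 := hBcoer (B' (J' f))
    rw [h1, Complex.zero_re] at h2
    have h3 : B' (J' f) = 0 := by
      have : ‖B' (J' f)‖ ^ 2 ≤ 0 := by
        by_contra! hpos
        exact absurd h2 (not_le.2 (mul_pos hc hpos))
      exact norm_eq_zero.1 (pow_eq_zero_iff two_ne_zero |>.1 (le_antisymm this (by positivity)))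
    have h4 : J' f = 0 := by rw [← hBB' (J' f), h3, map_zero]
    refine hdense f fun z => ?_
    rw [← ContinuousLinearMap.adjoint_inner_right, ← hJ', h4, inner_zero_right]
  obtain ⟨ι, v, μ, hv, hspan, heig⟩ := exists_orthonormal_eigenvectors hTc hTsymm hTker
  have hJw : ∀ i, J ((μ i : ℂ)⁻¹ • B' (J' (v i))) = v i := by
    intro i
    rw [map_smul]
    change (μ i : ℂ)⁻¹ • T (v i) = v i
    rw [(heig i).2, inv_smul_smul₀ (Complex.ofReal_ne_zero.2 (heig i).1)]
  refine ⟨ι, fun i => (μ i : ℂ)⁻¹ • B' (J' (v i)), fun i => (μ i)⁻¹ - C, ?_, ?_, fun i z => ?_⟩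
  · simpa only [hJw] using hv
  · simpa only [hJw] using hspan
  · have h1 := hB z ((μ i : ℂ)⁻¹ • B' (J' (v i)))
    rw [map_smul, hBB', inner_smul_right, hJ', ContinuousLinearMap.adjoint_inner_right, ← hJ',
      hJw] at h1
    rw [hJw]
    push_cast
    linear_combination -h1

end FormSpectrum

/-! ### Existence of the eigenvalue sequence -/

section Existence

variable {n : ℕ} {Ω : Set (EuclideanSpace ℝ (Fin n))}

/-- Infinitely many disjoint nonempty open subsets of `Ω` have nonzero, mutually orthogonal
indicators. This makes the index set of the eigenbasis infinite, so that it can be enumerated by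
`ℕ`. -/
theorem not_finiteDimensional_L2Space (hn : 0 < n) (hΩ : IsOpen Ω) (hb : Bornology.IsBounded Ω)
    (hne : Ω.Nonempty) : ¬ FiniteDimensional ℂ (L2Space Ω) := by
  intro hfd
  have : Nonempty (Fin n) := ⟨⟨0, hn⟩⟩
  have hinf : Infinite Ω :=
    Set.infinite_coe_iff.2 (infinite_of_mem_nhds hne.some (hΩ.mem_nhds hne.some_mem))
  obtain ⟨U, hUinf, hUo, hUd⟩ := exists_seq_infinite_isOpen_pairwise_disjoint (X := Ω)
  let V : ℕ → Set (EuclideanSpace ℝ (Fin n)) := fun k => Subtype.val '' U k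
  have hVo : ∀ k, IsOpen (V k) := fun k => hΩ.isOpenMap_subtype_val _ (hUo k)
  have hVΩ : ∀ k, V k ⊆ Ω := fun k => by
    rintro _ ⟨x, -, rfl⟩
    exact x.2
  have hVfin : ∀ k, volume.restrict Ω (V k) ≠ ⊤ := fun k =>
    ((Measure.restrict_apply_le Ω (V k)).trans_lt (hb.subset (hVΩ k)).measure_lt_top).ne
  have hVpos : ∀ k, volume.restrict Ω (V k) ≠ 0 := fun k => by
    rw [Measure.restrict_apply (hVo k).measurableSet, Set.inter_eq_left.2 (hVΩ k)]
    exact ((hVo k).measure_pos volume ((hUinf k).nonempty.image _)).ne'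
  let f : ℕ → L2Space Ω := fun k =>
    indicatorConstLp 2 (hVo k).measurableSet (hVfin k) (1 : ℂ)
  have hf0 : ∀ k, f k ≠ 0 := fun k h => by
    have := norm_indicatorConstLp (p := 2) (hs := (hVo k).measurableSet) (hμs := hVfin k)
      (c := (1 : ℂ)) (by norm_num) (by norm_num)
    rw [show indicatorConstLp 2 (hVo k).measurableSet (hVfin k) (1 : ℂ) = 0 from h, norm_zero,
      norm_one, one_mul] at this
    have hpos : 0 < (volume.restrict Ω).real (V k) := ENNReal.toReal_pos (hVpos k) (hVfin k)
    exact (Real.rpow_pos_of_pos hpos _).ne this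
  have horth : Pairwise fun k l => inner ℂ (f k) (f l) = 0 := by
    intro k l hkl
    have hd : Disjoint (V k) (V l) :=
      Set.disjoint_image_of_injective Subtype.val_injective (hUd hkl)
    rw [L2.inner_def]
    refine integral_eq_zero_of_ae ?_
    filter_upwards [indicatorConstLp_coeFn (p := 2) (hs := (hVo k).measurableSet)
        (hμs := hVfin k) (c := (1 : ℂ)),
      indicatorConstLp_coeFn (p := 2) (hs := (hVo l).measurableSet)
        (hμs := hVfin l) (c := (1 : ℂ))] with x h1 h2
    change inner ℂ ((f k) x) ((f l) x) = (0 : ℂ)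
    rw [h1, h2]
    by_cases hx : x ∈ V k
    · rw [Set.indicator_of_notMem (Set.disjoint_left.1 hd hx), inner_zero_right]
    · rw [Set.indicator_of_notMem hx, inner_zero_left]
  have hli : LinearIndependent ℂ f := linearIndependent_of_ne_zero_of_inner_eq_zero hf0 horth
  have := hli.finite
  exact not_finite ℕ

/-- Existence of a complete orthonormal system of Dirichlet eigenfunctions with nondecreasing
eigenvalues. -/
theorem exists_isDirichletEigenvalueSequence (hn : 3 ≤ n) (hΩ : IsOpen Ω)
    (hb : Bornology.IsBounded Ω) (hne : Ω.Nonempty) {q : EuclideanSpace ℝ (Fin n) → ℝ}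
    (hq : MemLp q ((n : ℝ≥0∞) / 2) (volume.restrict Ω)) :
    ∃ lam : ℕ → ℝ, IsDirichletEigenvalueSequence Ω q lam := by
  obtain ⟨A, hsymm, hform, hbound⟩ := exists_form_operator hn hq
  obtain ⟨C, hC0, hC⟩ := hbound (1 / 2) (by norm_num)
  -- Adding `(C + 1/2)‖u‖²` to the bound `½‖∇u‖² - C‖u‖²` completes half the squared graph norm.
  obtain ⟨ι, w, lam, horth, hspan, heig⟩ := exists_form_eigenvectors (isCompactOperator_val hb)
    (fun f hf => eq_zero_of_forall_inner_toL2 hΩ hb.measure_lt_top.ne f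
      fun φ hφ => hf (sobolevH10.ofTest hφ)) hsymm (c := 1 / 2) (C := C + 1 / 2) (by norm_num)
    (fun w => by
      have h1 := hC w
      rw [sobolevH10.norm_sq_eq]
      linarith)
  have hinf : Infinite ι := by
    by_contra hfin
    rw [not_infinite_iff_finite] at hfin
    have hfd := FiniteDimensional.span_of_finite ℂ
      (Set.finite_range fun i => sobolevH10.val (w i))
    rw [Submodule.orthogonal_eq_bot_iff] at hspan
    rw [hspan] at hfd
    exact not_finiteDimensional_L2Space (by lia) hΩ hb hne (Module.finite_def.2
      (Module.Finite.iff_fg.1 hfd))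
  have hdiag : ∀ j, (inner ℂ (w j) (A (w j)) : ℂ).re = lam j := by
    intro j
    rw [heig, inner_self_eq_ofReal_norm_sq, horth.1 j]
    simp
  -- `N` eigenvalues at most `t` force the Riesz sum at `t + 1` to be at least `N`, which the upper
  -- bound excludes for large `N`.
  have hfinite : ∀ t, {i | lam i ≤ t}.Finite := by
    intro t
    by_contra hinf
    obtain ⟨N, hN⟩ := exists_nat_gt ((1 - 1 / 2) * (volume.real Ω *
        ∫ ξ : EuclideanSpace ℝ (Fin n), weylSymbol ((t + 1 + C) / (1 - 1 / 2)) ξ))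
    obtain ⟨s, hs, hcard⟩ := Set.Infinite.exists_subset_card_eq hinf N
    have h := sum_sub_eigenvalue_le hb (by norm_num) hC horth hdiag s (t + 1)
    have h2 : (N : ℝ) ≤ ∑ j ∈ s, (t + 1 - lam j) := by
      calc (N : ℝ) = ∑ j ∈ s, (1 : ℝ) := by simp [hcard]
        _ ≤ _ := Finset.sum_le_sum fun j hj => by
          have : lam j ≤ t := hs hj
          linarith
    linarith
  obtain ⟨e, he⟩ := exists_equiv_nat_monotone lam hfinite
  have horth' : Orthonormal ℂ fun k => sobolevH10.val (w (e k)) := horth.comp e e.injective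
  have hrange : Set.range (fun k => sobolevH10.val (w (e k))) =
      Set.range fun i => sobolevH10.val (w i) :=
    e.surjective.range_comp fun i => sobolevH10.val (w i)
  refine ⟨lam ∘ e, he, HilbertBasis.mkOfOrthogonalEqBot horth' (by rw [hrange, hspan]),
    fun k => ?_⟩
  rw [HilbertBasis.coe_mkOfOrthogonalEqBot]
  exact (isDirichletEigenvector_iff hform).2 ⟨w (e k), rfl, heig (e k)⟩

end Existence

theorem propositionA {n : ℕ} (hn : 3 ≤ n) (Ω : Set (EuclideanSpace ℝ (Fin n)))
    (hΩ : IsSmoothBoundedDomain Ω) (q : EuclideanSpace ℝ (Fin n) → ℝ)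
    (hq : MemLp q ((n : ℝ≥0∞) / 2) (volume.restrict Ω)) :
    (∃ lam : ℕ → ℝ, IsDirichletEigenvalueSequence Ω q lam) ∧
    ∀ lam : ℕ → ℝ, IsDirichletEigenvalueSequence Ω q lam →
      lam ~[atTop] fun k : ℕ =>
        4 * Real.pi ^ 2 /
            (volume.real (Metric.ball (0 : EuclideanSpace ℝ (Fin n)) 1) * volume.real Ω)
              ^ (2 / (n : ℝ)) *
          ((k : ℝ) + 1) ^ (2 / (n : ℝ)) :=
  ⟨exists_isDirichletEigenvalueSequence hn hΩ.isOpen hΩ.isBounded hΩ.isConnected.nonempty hq,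
    fun _ hlam => dirichletEigenvalue_isEquivalent hn hΩ.isOpen hΩ.isBounded
      hΩ.isConnected.nonempty hq hlam⟩
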